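/- All graphs are finite and simple, and $d(v)$ denotes the degree of a vertex $v$. A linear forest is a forest every component of which is a path (a single vertex counts as a path). For a graph $G$, let $\alpha_{\mathcal L}(G)$ denote the maximum order of an induced subgraph of $G$ that is a linear forest. A function $f:\mathbb N\to[0,1]$ (where $0\in\mathbb N$) is called a lower bound for $\alpha_{\mathcal L}$ if $\alpha_{\mathcal L}(G)\ge\sum_{v\in V(G)}f(d(v))$ holds for every graph $G$. A lower bound $f$ is extremal if there is no $g:\mathbb N\to[0,1]$ with $g\not\equiv 0$ such that $f+g$ is also a lower bound for $\alpha_{\mathcal L}$. A lower bound $f$ is dominated by a lower bound $f'$ if $f(d)\le f'(d)$ for every $d\in\mathbb N$. For $\varepsilon\in\mathbb R$ with $0\le\varepsilon\le\frac16$, define $f_\varepsilon:\mathbb N\to[0,1]$ by $f_\varepsilon(0)=1$, $f_\varepsilon(1)=1-\varepsilon$, $f_\varepsilon(2)=\frac23$, and $f_\varepsilon(d)=\min\{3\varepsilon,\frac{2}{d+1}\}$ for $d\ge3$. Theorem. For every $\varepsilon\in\mathbb R$ with $0\le\varepsilon\le\frac16$, the function $f_\varepsilon$ is a lower bound for $\alpha_{\mathcal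 L}$, and this lower bound is extremal. Moreover, every lower bound for $\alpha_{\mathcal L}$ is dominated by $f_\varepsilon$ for some $\varepsilon$ with $0\le\varepsilon\le\frac16$. -/

import Mathlib

namespace InducedSubgraphBounds

/-- A graph class: a property of graphs. -/
abbrev GraphClass : Type 1 := ∀ V : Type, SimpleGraph V → Prop

/-- A linear forest is a forest each of whose components is a path
(a single vertex is a path). -/
def LinearForest : GraphClass := fun _ G =>
  G.IsAcyclic ∧ ∀ c : G.ConnectedComponent,
    ∃ n : ℕ, Nonempty (c.toSimpleGraph ≃g SimpleGraph.pathGraph n)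

open Classical in
/-- The maximum order of an induced subgraph of the finite graph `G` that belongs to `C`. -/
noncomputable def maxInducedOrder (C : GraphClass) {V : Type} [Fintype V]
    (G : SimpleGraph V) : ℕ :=
  (Finset.univ.filter fun S : Finset V => C _ (G.induce (S : Set V))).sup Finset.card

/-- `f` is a `[0, 1]`-valued function of the degree, and `∑ v, f (d(v))` is at most the maximum
order of an induced subgraph in `C`, for every finite graph. -/
def IsLowerBound (C : GraphClass) (f : ℕ → ℝ) : Prop :=
  (∀ d, f d ∈ Set.Icc (0 : ℝ) 1) ∧
    ∀ (V : Type) [Fintype V] (G : SimpleGraph V) [DecidableRel G.Adj],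
      ∑ v : V, f (G.degree v) ≤ (maxInducedOrder C G : ℝ)

/-- A lower bound is extremal if it cannot be augmented. -/
def IsExtremalLowerBound (C : GraphClass) (f : ℕ → ℝ) : Prop :=
  IsLowerBound C f ∧
    ¬ ∃ g : ℕ → ℝ, (∀ d, g d ∈ Set.Icc (0 : ℝ) 1) ∧ g ≠ 0 ∧ IsLowerBound C (f + g)

/-- `f` is dominated by `f'` if `f(d) ≤ f'(d)` for every `d`. -/
def IsDominatedBy (f f' : ℕ → ℝ) : Prop := ∀ d, f d ≤ f' d

/-- The function `f_ε`. -/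
noncomputable def fEps (ε : ℝ) : ℕ → ℝ
  | 0 => 1
  | 1 => 1 - ε
  | 2 => 2 / 3
  | d + 3 => min (3 * ε) (2 / (((d + 3 : ℕ) : ℝ) + 1))

end InducedSubgraphBounds

/-!
The second half of the theorem is short. Complete graphs show `f d ≤ 2 / (d + 1)` for `d ≥ 2`, and
complete graphs with three ends at every vertex show `3 f(1) + f(d) ≤ 3` for `d ≥ 3`; so `f` is
dominated by `fEps ε` for `ε = min (1 - f 1) (1 / 6)` (`exists_isDominatedBy_fEps`). Extremality
follows because no two of the functions `fEps ε` are comparable.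

To see that `fEps ε` is a lower bound, consider first a vertex `v` of degree at least `3` with
three neighbours of degree `1` or `2`. Deleting `v` loses at most `3 ε`, and each of the three
gains at least `ε`. If no such vertex is left, put all ends (vertices of degree `1`) into the
forest. What remains is a graph in which a vertex with `k ≤ 2` ends may have only `2 - k` further
neighbours in the forest, its capacity. Each end has contributed `1` instead of `1 - ε`, and hands
the surplus `ε` to its neighbour. Since `x ≤ 3 ε` and `x ≤ 2 / (d + 1)` imply
`x - k ε ≤ (1 - k / 3) * 2 / (d + 1)`, the parameter `ε` disappears (`fEps_sub_le_vertexWeight`):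
it suffices to find a forest respecting the capacities whose order is at least the sum of weights
that depend only on capacity and degree, and essentially are `(2 / 3) (c + 1) / (d + 1)` for
capacity `c` and degree `d` (`reach_vertexWeight`).

These weights satisfy `weight = d * drop`, where the drop is the gain from losing one neighbour.
So a vertex whose drop is minimum can be deleted: each of its `d` neighbours gains at least as much
(`Critical.small`). This breaks down at small degrees, where the weights have to be modified and
where a minimal counterexample is examined by hand. It has no vertex of capacity `0`
(`Critical.ne_zero`). After that, deletions in the order of increasing drop leave only degrees at
most `3`, an end is absorbed into its neighbour at the cost of one unit of capacity
(`Critical.two_le_card_nbrs`), and no vertex of capacity `1` survives (`Critical.ne_one`). For the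
remaining graph the bound `n - m / 3` suffices (`reach_of_two_le`).
-/

open Finset

set_option linter.unusedSectionVars false

namespace LinearForestBound

/-! ### Capacitated linear forests -/

section Capacities

variable {V : Type*} [DecidableEq V] (G : SimpleGraph V) [DecidableRel G.Adj]

/-- The neighbours of `v` inside the vertex set `X`. -/
def nbrs (X : Finset V) (v : V) : Finset V := X.filter (G.Adj v)

/-- `S` induces a forest in which every vertex `v ∈ S` has degree at most its capacity `c v`.
Acyclicity is encoded as `1`-degeneracy: every nonempty `T ⊆ S` has a vertex with at most one
neighbour in `T`. With `c = 2` this says that `S` induces a linear forest. -/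
def IsCapForest (c : V → ℕ) (S : Finset V) : Prop :=
  (∀ T ⊆ S, T.Nonempty → ∃ v ∈ T, #(nbrs G T v) ≤ 1) ∧ ∀ v ∈ S, #(nbrs G S v) ≤ c v

/-- `X` contains a capacitated forest of at least `r / 18` vertices. Counting a vertex as `18`
makes the weights below small numbers. -/
def Reach (c : V → ℕ) (X : Finset V) (r : ℝ) : Prop :=
  ∃ S ⊆ X, IsCapForest G c S ∧ r ≤ 18 * (#S : ℝ)

variable {G} {c c' : V → ℕ} {X Y D A S : Finset V} {u v w x : V} {r s : ℝ}

lemma mem_nbrs : u ∈ nbrs G X v ↔ u ∈ X ∧ G.Adj v u := by simp [nbrs]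

lemma nbrs_subset : nbrs G X v ⊆ X := filter_subset _ _

lemma nbrs_mono (h : X ⊆ Y) : nbrs G X v ⊆ nbrs G Y v := filter_subset_filter _ h

lemma card_nbrs_sdiff (h : D ⊆ X) : #(nbrs G (X \ D) v) + #(nbrs G D v) = #(nbrs G X v) := by
  unfold nbrs
  rw [← card_union_of_disjoint]
  · rw [← filter_union, sdiff_union_of_subset h]
  · exact disjoint_filter_filter sdiff_disjoint

/-- Double counting of the edges between two vertex sets. -/
lemma sum_card_nbrs_comm (A B : Finset V) :
    ∑ a ∈ A, #(nbrs G B a) = ∑ b ∈ B, #(nbrs G A b) := by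
  simp only [nbrs, card_filter]
  rw [sum_comm]
  simp only [G.adj_comm]

lemma Reach.mono (h : Reach G c X r) (hs : s ≤ r) : Reach G c X s := by
  obtain ⟨S, h1, h2, h3⟩ := h
  exact ⟨S, h1, h2, hs.trans h3⟩

lemma isCapForest_empty : IsCapForest G c ∅ :=
  ⟨fun _ hT hne => absurd (subset_empty.1 hT) hne.ne_empty, by simp⟩

lemma isCapForest_singleton : IsCapForest G c {v} := by
  refine ⟨fun T hT hne => ?_, ?_⟩
  · obtain ⟨x, hx⟩ := hne
    exact ⟨x, hx, (card_le_card nbrs_subset).trans ((card_le_card hT).trans (by simp))⟩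
  · simp [nbrs, filter_singleton]

lemma isCapForest_pair (h1 : 1 ≤ c u) (h2 : 1 ≤ c v) : IsCapForest G c {u, v} := by
  have key : ∀ T ⊆ ({u, v} : Finset V), ∀ x ∈ T, #(nbrs G T x) ≤ 1 := by
    intro T hT x hx
    have : nbrs G T x ⊆ ({u, v} : Finset V).erase x := fun y hy => by
      rw [mem_nbrs] at hy
      exact mem_erase.2 ⟨hy.2.ne', hT hy.1⟩
    refine (card_le_card this).trans ?_
    rw [card_erase_of_mem (hT hx)]
    have := card_le_two (a := u) (b := v)
    omega
  refine ⟨fun T hT ⟨x, hx⟩ => ⟨x, hx, key T hT x hx⟩, fun x hx => ?_⟩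
  refine (key _ subset_rfl x hx).trans ?_
  rcases mem_insert.1 hx with rfl | hx
  · exact h1
  · rwa [mem_singleton.1 hx]

/-- Two capacitated forests without edges between them may be united; the edges are excluded
through a vertex set `Y` around the second one. -/
lemma IsCapForest.union (hA : IsCapForest G c A) (hS : IsCapForest G c S) (hSY : S ⊆ Y)
    (hno : ∀ a ∈ A, ∀ y ∈ Y, ¬ G.Adj a y) : IsCapForest G c (A ∪ S) := by
  have h1 : ∀ T ⊆ A ∪ S, ∀ a ∈ A, nbrs G T a ⊆ nbrs G (T ∩ A) a := by
    intro T hT a ha y hy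
    rw [mem_nbrs] at hy ⊢
    refine ⟨mem_inter.2 ⟨hy.1, ?_⟩, hy.2⟩
    rcases mem_union.1 (hT hy.1) with h | h
    · exact h
    · exact absurd hy.2 (hno a ha y (hSY h))
  have h2 : ∀ T ⊆ A ∪ S, ∀ a ∈ S, nbrs G T a ⊆ nbrs G (T ∩ S) a := by
    intro T hT a ha y hy
    rw [mem_nbrs] at hy ⊢
    refine ⟨mem_inter.2 ⟨hy.1, ?_⟩, hy.2⟩
    rcases mem_union.1 (hT hy.1) with h | h
    · exact absurd hy.2.symm (hno y h a (hSY ha))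
    · exact h
  refine ⟨fun T hT hne => ?_, fun x hx => ?_⟩
  · by_cases h : (T ∩ A).Nonempty
    · obtain ⟨x, hx, hx2⟩ := hA.1 (T ∩ A) inter_subset_right h
      exact ⟨x, (mem_inter.1 hx).1,
        (card_le_card (h1 T hT x (mem_inter.1 hx).2)).trans hx2⟩
    · have h3 : (T ∩ S).Nonempty := by
        obtain ⟨x, hx⟩ := hne
        rcases mem_union.1 (hT hx) with h' | h'
        · exact absurd ⟨x, mem_inter.2 ⟨hx, h'⟩⟩ h
        · exact ⟨x, mem_inter.2 ⟨hx, h'⟩⟩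
      obtain ⟨x, hx, hx2⟩ := hS.1 (T ∩ S) inter_subset_right h3
      exact ⟨x, (mem_inter.1 hx).1,
        (card_le_card (h2 T hT x (mem_inter.1 hx).2)).trans hx2⟩
  · rcases mem_union.1 hx with h | h
    · exact (card_le_card ((h1 _ subset_rfl x h).trans (nbrs_mono inter_subset_right))).trans
        (hA.2 x h)
    · exact (card_le_card ((h2 _ subset_rfl x h).trans (nbrs_mono inter_subset_right))).trans
        (hS.2 x h)

/-- Adding a vertex `e` with at most one neighbour `v`, which costs one unit of the capacity
of `v`. -/
lemma IsCapForest.insert_end {e : V} (hS : IsCapForest G c' S) (hSY : S ⊆ Y) (he : e ∉ Y)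
    (hce : 1 ≤ c e) (hev : ∀ y ∈ Y, G.Adj e y → y = v) (hv : c' v + 1 ≤ c v)
    (hc : ∀ y ∈ Y, y ≠ v → c' y ≤ c y) : IsCapForest G c (insert e S) := by
  have h1 : ∀ T ⊆ insert e S, nbrs G T e ⊆ {v} := by
    intro T hT y hy
    rw [mem_nbrs] at hy
    rcases mem_insert.1 (hT hy.1) with h | h
    · exact absurd h hy.2.ne'
    · exact mem_singleton.2 (hev y (hSY h) hy.2)
  refine ⟨fun T hT hne => ?_, fun x hx => ?_⟩
  · by_cases h : e ∈ T
    · exact ⟨e, h, (card_le_card (h1 T hT)).trans (by simp)⟩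
    · exact hS.1 T ((subset_insert_iff_of_notMem h).1 hT) hne
  · rcases mem_insert.1 hx with rfl | h
    · exact (card_le_card (h1 _ subset_rfl)).trans (by simpa using hce)
    · have h3 : #(nbrs G (insert e S) x) ≤ #(nbrs G S x) + 1 := by
        unfold nbrs
        rw [filter_insert]
        split_ifs
        · exact card_insert_le _ _
        · omega
      by_cases hxv : x = v
      · subst hxv
        exact h3.trans ((Nat.add_le_add_right (hS.2 x h) 1).trans hv)
      · have h4 : nbrs G (insert e S) x ⊆ nbrs G S x := by
          intro y hy
          rw [mem_nbrs] at hy ⊢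
          rcases mem_insert.1 hy.1 with rfl | h'
          · exact absurd (hev x (hSY h) hy.2.symm) hxv
          · exact ⟨h', hy.2⟩
        exact (card_le_card h4).trans ((hS.2 x h).trans (hc x (hSY h) hxv))

/-- Removing `D` from `X` while putting `A ⊆ D` into the forest. -/
lemma Reach.take (hr : Reach G c (X \ D) r) (hD : D ⊆ X) (hAD : A ⊆ D) (hA : IsCapForest G c A)
    (hno : ∀ a ∈ A, ∀ y ∈ X, G.Adj a y → y ∈ D) : Reach G c X (18 * #A + r) := by
  obtain ⟨S, h1, h2, h3⟩ := hr
  refine ⟨A ∪ S, union_subset (hAD.trans hD) (h1.trans sdiff_subset), hA.union h2 h1 ?_, ?_⟩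
  · intro a ha y hy hadj
    rw [mem_sdiff] at hy
    exact hy.2 (hno a ha y hy.1 hadj)
  · rw [card_union_of_disjoint (disjoint_sdiff.mono hAD h1)]
    push_cast
    linarith

/-- Removing `D` from `X` while putting one vertex `e ∈ D` into the forest, whose only neighbour
outside `D` is `v`. -/
lemma Reach.absorb {e : V} (hr : Reach G c' (X \ D) r) (hD : D ⊆ X) (he : e ∈ D)
    (hce : 1 ≤ c e) (hev : ∀ y ∈ X, G.Adj e y → y = v ∨ y ∈ D) (hv : c' v + 1 ≤ c v)
    (hc : ∀ y, y ≠ v → c' y ≤ c y) : Reach G c X (18 + r) := by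
  obtain ⟨S, h1, h2, h3⟩ := hr
  have heS : e ∉ X \ D := fun h => (mem_sdiff.1 h).2 he
  refine ⟨insert e S, insert_subset (hD he) (h1.trans sdiff_subset),
    h2.insert_end h1 heS hce ?_ hv fun y _ => hc y, ?_⟩
  · intro y hy hadj
    rw [mem_sdiff] at hy
    exact (hev y hy.1 hadj).resolve_right hy.2
  · rw [card_insert_of_notMem fun h => heS (h1 h)]
    push_cast
    linarith

end Capacities

/-! ### Exchange arguments -/

section Exchange

variable {V : Type*} [DecidableEq V] {G : SimpleGraph V} [DecidableRel G.Adj]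
variable {c c' : V → ℕ} {X Y D A S : Finset V} {u v w x : V}

/-- If the weights `g` on `X` are not attained although the weights `h` on `X \ D` are, then the
exchange of `D` for `A` must lose weight. -/
lemma take_lt_of_not_reach {g h : V → ℝ} (hX : ¬ Reach G c X (∑ v ∈ X, g v))
    (hY : Reach G c (X \ D) (∑ v ∈ X \ D, h v)) (hD : D ⊆ X) (hAD : A ⊆ D)
    (hA : IsCapForest G c A) (hno : ∀ a ∈ A, ∀ y ∈ X, G.Adj a y → y ∈ D) :
    18 * (#A : ℝ) + ∑ v ∈ X \ D, (h v - g v) < ∑ v ∈ D, g v := by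
  by_contra hcon
  refine hX ((hY.take hD hAD hA hno).mono ?_)
  rw [sum_sub_distrib] at hcon
  rw [← sum_sdiff hD]
  linarith

/-- The analogue of `take_lt_of_not_reach` for the absorption of a vertex `e` into `v`. -/
lemma absorb_lt_of_not_reach {e : V} {g h : V → ℝ} (hX : ¬ Reach G c X (∑ v ∈ X, g v))
    (hY : Reach G c' (X \ D) (∑ v ∈ X \ D, h v)) (hD : D ⊆ X) (he : e ∈ D)
    (hce : 1 ≤ c e) (hev : ∀ y ∈ X, G.Adj e y → y = v ∨ y ∈ D) (hv : c' v + 1 ≤ c v)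
    (hc : ∀ y, y ≠ v → c' y ≤ c y) :
    18 + ∑ v ∈ X \ D, (h v - g v) < ∑ v ∈ D, g v := by
  by_contra hcon
  refine hX ((hY.absorb hD he hce hev hv hc).mono ?_)
  rw [sum_sub_distrib] at hcon
  rw [← sum_sdiff hD]
  linarith

lemma nbrs_sdiff_singleton : nbrs G (X \ {v}) v = nbrs G X v := by
  ext y
  simp only [mem_nbrs, mem_sdiff, mem_singleton]
  constructor
  · exact fun h => ⟨h.1.1, h.2⟩
  · exact fun h => ⟨⟨h.1, h.2.ne'⟩, h.2⟩

/-- A gain of `τ` for every edge leaving `D`. -/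
lemma mul_sum_card_nbrs_le {g h : V → ℝ} {τ : ℝ}
    (hτ : ∀ v ∈ X \ D, g v + #(nbrs G D v) * τ ≤ h v) :
    τ * ((∑ a ∈ D, #(nbrs G (X \ D) a) : ℕ) : ℝ) ≤ ∑ v ∈ X \ D, (h v - g v) := by
  rw [sum_card_nbrs_comm, Nat.cast_sum, mul_sum]
  exact sum_le_sum fun v hv => by linarith [hτ v hv]

lemma exists_other (h : #(nbrs G X v) = 2) (hu : u ∈ nbrs G X v) :
    ∃ w, w ≠ u ∧ nbrs G X v = {u, w} := by
  obtain ⟨a, b, hab, he⟩ := card_eq_two.1 h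
  rw [he, mem_insert, mem_singleton] at hu
  rcases hu with rfl | rfl
  · exact ⟨b, hab.symm, he⟩
  · exact ⟨a, hab, by rw [he, pair_comm]⟩

end Exchange

/-! ### The bound `n - m / 3` for graphs with full capacities -/

section EdgeBound

variable {V : Type*} [DecidableEq V] {G : SimpleGraph V} [DecidableRel G.Adj]

/-- The weight `1 - d / 6` of a vertex of degree `d`, summing up to `n - m / 3`, is attained
whenever capacities restrict degrees only above `2`. Vertices of degree at least `3` are deleted,
an end is absorbed into its neighbour, and of a cycle one vertex is deleted. -/
theorem reach_of_two_le (X : Finset V) : ∀ c : V → ℕ,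
    (∀ v ∈ X, min 2 #(nbrs G X v) ≤ c v) →
      Reach G c X (∑ v ∈ X, (18 - 3 * (#(nbrs G X v) : ℝ))) := by
  induction X using Finset.strongInduction with
  | H X ih =>
  intro c hc
  by_contra hX
  have hsub : ∀ {D : Finset V}, D ⊆ X → D.Nonempty → X \ D ⊂ X :=
    fun hD hne => sdiff_ssubset hD hne
  have hgain : ∀ {D : Finset V}, D ⊆ X →
      (3 : ℝ) * ((∑ a ∈ D, #(nbrs G (X \ D) a) : ℕ) : ℝ) ≤
        ∑ v ∈ X \ D, ((18 - 3 * (#(nbrs G (X \ D) v) : ℝ)) - (18 - 3 * (#(nbrs G X v) : ℝ))) := by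
    intro D hD
    refine mul_sum_card_nbrs_le fun v _ => ?_
    rw [← card_nbrs_sdiff (v := v) hD]
    push_cast
    linarith
  have hcD : ∀ {D : Finset V}, D ⊆ X → ∀ v ∈ X \ D, min 2 #(nbrs G (X \ D) v) ≤ c v := by
    intro D _ v hv
    have h1 := hc v (mem_sdiff.1 hv).1
    have h2 := card_le_card (nbrs_mono (G := G) (v := v) (sdiff_subset (s := X) (t := D)))
    omega
  have hle : ∀ v ∈ X, #(nbrs G X v) ≤ 2 := by
    intro v hv
    have hD : {v} ⊆ X := singleton_subset_iff.2 hv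
    have h := take_lt_of_not_reach hX (ih _ (hsub hD (by simp)) c (hcD hD)) hD
      (empty_subset _) isCapForest_empty (by simp)
    have h2 := hgain hD
    simp only [sum_singleton, nbrs_sdiff_singleton, card_empty, Nat.cast_zero, mul_zero,
      zero_add] at h h2
    have h3 : (#(nbrs G X v) : ℝ) < 3 := by linarith
    have h4 : #(nbrs G X v) < 3 := by exact_mod_cast h3
    omega
  -- Absorbing `e` into `v` after deleting the rest of `D`.
  have habs : ∀ {D : Finset V} {e v : V}, D ⊆ X → e ∈ D → v ∈ X → G.Adj e v →
      (∀ y ∈ X, G.Adj e y → y = v ∨ y ∈ D) →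
      (18 : ℝ) + 3 * ((∑ a ∈ D, #(nbrs G (X \ D) a) : ℕ) : ℝ) <
        ∑ v ∈ D, (18 - 3 * (#(nbrs G X v) : ℝ)) := by
    intro D e v hD he hv hadj hev
    have hpos : ∀ {a b}, b ∈ X → G.Adj a b → 1 ≤ #(nbrs G X a) := fun hb hab =>
      card_pos.2 ⟨_, mem_nbrs.2 ⟨hb, hab⟩⟩
    have hv1 := hpos (hD he) hadj.symm
    have he1 := hpos hv hadj
    have hcv := hc v hv
    have hce := hc e (hD he)
    have hY := ih (X \ D) (hsub hD ⟨e, he⟩) (Function.update c v (c v - 1)) (by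
      intro y hy
      by_cases hyv : y = v
      · subst hyv
        have h1 := card_nbrs_sdiff (G := G) (v := y) hD
        have h2 : 1 ≤ #(nbrs G D y) := card_pos.2 ⟨e, mem_nbrs.2 ⟨he, hadj.symm⟩⟩
        have h3 := hle y hv
        simp only [Function.update_self]
        omega
      · rw [Function.update_of_ne hyv]
        exact hcD hD y hy)
    have h := absorb_lt_of_not_reach (v := v) hX hY hD he (by omega) hev
      (by simp only [Function.update_self]; omega)
      (fun y hy => by rw [Function.update_of_ne hy])
    linarith [hgain hD]
  have heq : ∀ v ∈ X, #(nbrs G X v) = 2 := by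
    intro e he
    have h2 := hle e he
    have hD : {e} ⊆ X := singleton_subset_iff.2 he
    by_contra hne
    obtain h0 | h1 : #(nbrs G X e) = 0 ∨ #(nbrs G X e) = 1 := by omega
    · have h := take_lt_of_not_reach hX (ih _ (hsub hD (by simp)) c (hcD hD)) hD
        subset_rfl isCapForest_singleton (by
          intro a ha y hy hadj
          rw [mem_singleton.1 ha] at hadj
          rw [card_eq_zero] at h0
          exact absurd (mem_nbrs.2 ⟨hy, hadj⟩) (h0 ▸ notMem_empty y))
      have h2 := hgain hD
      simp only [sum_singleton, nbrs_sdiff_singleton, h0, card_singleton] at h h2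
      norm_num at h h2
      linarith
    · obtain ⟨v, hv⟩ := card_eq_one.1 h1
      have hv' : v ∈ nbrs G X e := by simp [hv]
      rw [mem_nbrs] at hv'
      have h := habs hD (mem_singleton_self e) hv'.1 hv'.2 (fun y hy hadj => by
        have : y ∈ nbrs G X e := mem_nbrs.2 ⟨hy, hadj⟩
        rw [hv, mem_singleton] at this
        exact Or.inl this)
      simp only [sum_singleton, nbrs_sdiff_singleton, h1] at h
      norm_num at h
  obtain rfl | ⟨v, hv⟩ := X.eq_empty_or_nonempty
  · exact hX ⟨∅, subset_rfl, isCapForest_empty, by simp⟩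
  obtain ⟨y, hy⟩ : (nbrs G X v).Nonempty := card_pos.1 (by rw [heq v hv]; omega)
  obtain ⟨z, hzy, hz⟩ := exists_other (heq v hv) hy
  rw [mem_nbrs] at hy
  obtain ⟨y', hy'v, hy'⟩ := exists_other (heq y hy.1) (mem_nbrs.2 ⟨hv, hy.2.symm⟩)
  have hy'm : y' ∈ nbrs G X y := by simp [hy']
  rw [mem_nbrs] at hy'm
  have hne : v ≠ y := hy.2.ne
  have hD : ({v, y} : Finset V) ⊆ X := insert_subset hv (singleton_subset_iff.2 hy.1)
  have h := habs hD (e := y) (v := y') (by simp) hy'm.1 hy'm.2 (fun x hx hadj => by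
    have : x ∈ nbrs G X y := mem_nbrs.2 ⟨hx, hadj⟩
    rw [hy'] at this
    simp only [mem_insert, mem_singleton] at this ⊢
    tauto)
  have h1 : 1 ≤ #(nbrs G (X \ {v, y}) v) := card_pos.2 ⟨z, by
    have : z ∈ nbrs G X v := by simp [hz]
    rw [mem_nbrs] at this ⊢
    exact ⟨by simp [this.1, hzy, this.2.ne'], this.2⟩⟩
  have h2 : 1 ≤ #(nbrs G (X \ {v, y}) y) := card_pos.2 ⟨y', by
    rw [mem_nbrs]
    exact ⟨by simp [hy'm.1, hy'v, hy'm.2.ne'], hy'm.2⟩⟩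
  rw [sum_pair hne, sum_pair hne, heq v hv, heq y hy.1] at h
  have h3 : (2 : ℝ) ≤ ((#(nbrs G (X \ {v, y}) v) + #(nbrs G (X \ {v, y}) y) : ℕ) : ℝ) := by
    exact_mod_cast Nat.add_le_add h1 h2
  norm_num at h h3
  linarith

end EdgeBound

/-! ### The weights -/

open Classical in
/-- The weight of a vertex of capacity `c` and degree `d`, where `b` says that it has a neighbour
of capacity `0`. The generic value is `12 (min c 2 + 1) / (d + 1)`. The values of degree at most
`2` are adjusted; vertices next to a vertex of capacity `0` get less there. -/
noncomputable def weight (c d : ℕ) (b : Prop) : ℝ :=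
  if d = 0 then 18
  else if d = 1 then (if c = 0 then 7 else if b then 11 else 14)
  else if c = 0 then 12 / (d + 1)
  else if c = 1 then 24 / (d + 1)
  else if d = 2 then (if b then 10 else 12)
  else 36 / (d + 1)

/-- The gain in weight of a vertex that loses a neighbour. -/
noncomputable def drop (c d : ℕ) (b : Prop) : ℝ := weight c (d - 1) b - weight c d b

/-- The pairs of capacity and degree, the latter positive, for which the drop is at least `1`. -/
def Small (c d : ℕ) : Prop := (c = 0 → d ≤ 3) ∧ (c = 1 → d ≤ 4) ∧ d ≤ 5

section Weights

variable {c d k : ℕ} {b b' : Prop} {τ : ℝ}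

lemma weight_zero : weight c 0 b = 18 := by simp [weight]

lemma weight_flag_le (h : b' → b) : weight c d b ≤ weight c d b' := by
  unfold weight
  by_cases hb' : b'
  · simp [h hb', hb']
  · by_cases hb : b
    · simp only [hb, hb', if_true, if_false]
      split_ifs <;> norm_num
    · simp [hb, hb']

lemma one_le_drop (hd : 1 ≤ d) (h : Small c d) : 1 ≤ drop c d b := by
  obtain ⟨h0, h1, h2⟩ := h
  unfold drop weight
  by_cases hc0 : c = 0
  · subst hc0
    have := h0 rfl
    interval_cases d <;> norm_num
  by_cases hc1 : c = 1
  · subst hc1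
    have := h1 rfl
    by_cases hb : b <;> interval_cases d <;> norm_num [hb]
  by_cases hb : b <;> interval_cases d <;> norm_num [hb, hc0, hc1]

/-- The generic weights satisfy `weight = d * drop`, so that a vertex of minimum drop may be
deleted. -/
lemma weight_eq_mul_drop_and_drop_lt_one (hd : 1 ≤ d) (h : ¬ Small c d) :
    weight c d b = d * drop c d b ∧ drop c d b < 1 := by
  have key : ∀ m : ℝ, m / d - m / (d + 1) = m / (d * (d + 1)) := by
    intro m
    have : (d : ℝ) ≠ 0 := by positivity
    field_simp
    ring
  have hpos : (0 : ℝ) < d * (d + 1) := by positivity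
  have hcast : ((d - 1 : ℕ) : ℝ) = d - 1 := by push_cast [hd]; ring
  have hd0 : (d : ℝ) ≠ 0 := by positivity
  by_cases hc0 : c = 0
  · have hd4 : 4 ≤ d := by unfold Small at h; omega
    have hd4' : (4 : ℝ) ≤ d := by exact_mod_cast hd4
    have : drop c d b = 12 / (d * (d + 1)) := by
      unfold drop weight
      rw [if_neg (by omega), if_neg (by omega), if_pos hc0, if_neg (by omega), if_neg (by omega),
        if_pos hc0, hcast, sub_add_cancel, key]
    rw [this]
    refine ⟨?_, by rw [div_lt_one hpos]; nlinarith⟩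
    unfold weight
    rw [if_neg (by omega), if_neg (by omega), if_pos hc0]
    field_simp
  by_cases hc1 : c = 1
  · have hd4 : 5 ≤ d := by unfold Small at h; omega
    have hd4' : (5 : ℝ) ≤ d := by exact_mod_cast hd4
    have : drop c d b = 24 / (d * (d + 1)) := by
      unfold drop weight
      rw [if_neg (by omega), if_neg (by omega), if_neg hc0, if_pos hc1, if_neg (by omega),
        if_neg (by omega), if_neg hc0, if_pos hc1, hcast, sub_add_cancel, key]
    rw [this]
    refine ⟨?_, by rw [div_lt_one hpos]; nlinarith⟩
    unfold weight
    rw [if_neg (by omega), if_neg (by omega), if_neg hc0, if_pos hc1]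
    field_simp
  · have hd4 : 6 ≤ d := by unfold Small at h; omega
    have hd4' : (6 : ℝ) ≤ d := by exact_mod_cast hd4
    have : drop c d b = 36 / (d * (d + 1)) := by
      unfold drop weight
      rw [if_neg (by omega), if_neg (by omega), if_neg hc0, if_neg hc1, if_neg (by omega),
        if_neg (by omega), if_neg (by omega), if_neg hc0, if_neg hc1, if_neg (by omega),
        hcast, sub_add_cancel, key]
    rw [this]
    refine ⟨?_, by rw [div_lt_one hpos]; nlinarith⟩
    unfold weight
    rw [if_neg (by omega), if_neg (by omega), if_neg hc0, if_neg hc1, if_neg (by omega)]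
    field_simp

lemma drop_nonneg : 0 ≤ drop c d b := by
  obtain rfl | hd := Nat.eq_zero_or_pos d
  · simp [drop]
  by_cases h : Small c d
  · exact zero_le_one.trans (one_le_drop hd h)
  · obtain ⟨h1, -⟩ := weight_eq_mul_drop_and_drop_lt_one (b := b) hd h
    have h2 : 0 ≤ weight c d b := by unfold weight; split_ifs <;> positivity
    rw [h1] at h2
    exact nonneg_of_mul_nonneg_right h2 (by positivity)

/-- A lower bound `τ` for the drops at all degrees up to `d` is gained for every lost
neighbour. -/
lemma weight_add_mul_le (h : ∀ d', 1 ≤ d' → d' ≤ d → τ ≤ drop c d' b) (hk : k ≤ d)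
    (hb : b' → b) : weight c d b + k * τ ≤ weight c (d - k) b' := by
  refine le_trans ?_ (weight_flag_le hb)
  induction k with
  | zero => simp
  | succ k ih =>
    have h1 := h (d - k) (by omega) (by omega)
    have h2 := ih (by omega)
    unfold drop at h1
    rw [show d - k - 1 = d - (k + 1) by omega] at h1
    push_cast
    linarith

lemma weight_mono (hk : k ≤ d) (hb : b' → b) : weight c d b ≤ weight c (d - k) b' := by
  have := weight_add_mul_le (τ := 0) (c := c) (fun d' _ _ => drop_nonneg) hk hb
  simpa using this

lemma Small.mono (h : Small c d) {d' : ℕ} (hd : d' ≤ d) : Small c d' :=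
  ⟨fun h0 => hd.trans (h.1 h0), fun h0 => hd.trans (h.2.1 h0), hd.trans h.2.2⟩

/-- Next to a vertex of capacity `0` no weight exceeds `11`, so that such a pair weighs at most
`18`. -/
lemma weight_flagged_le (hd : 1 ≤ d) (hb : b) : weight c d b ≤ 11 := by
  unfold weight
  have h2 : (1 : ℝ) ≤ d := by exact_mod_cast hd
  have h3 : d ≠ 0 → d ≠ 1 → (2 : ℝ) ≤ d := fun h h' => by exact_mod_cast (by omega : 2 ≤ d)
  have h4 : d ≠ 0 → d ≠ 1 → d ≠ 2 → (3 : ℝ) ≤ d := fun h h' h'' => by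
    exact_mod_cast (by omega : 3 ≤ d)
  have h5 : (0 : ℝ) < d + 1 := by positivity
  split_ifs with h h' <;> first | omega | norm_num
  all_goals rw [div_le_iff₀ h5]
  · linarith [h3 h h']
  · linarith [h3 h h']
  · rename_i h6 h7 h8
    linarith [h4 h h' h8]

end Weights

/-! ### Minimal counterexamples -/

section Critical

variable {V : Type*} [DecidableEq V] (G : SimpleGraph V) [DecidableRel G.Adj]

/-- `v` has a neighbour of capacity `0` in `X`. -/
def Flagged (c : V → ℕ) (X : Finset V) (v : V) : Prop := ∃ u ∈ nbrs G X v, c u = 0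

/-- The weight of the vertex `v` of the graph induced by `X`. -/
noncomputable def vertexWeight (c : V → ℕ) (X : Finset V) (v : V) : ℝ :=
  weight (c v) #(nbrs G X v) (Flagged G c X v)

/-- A minimal counterexample to the statement that the weights are attained. -/
structure Critical (c : V → ℕ) (X : Finset V) : Prop where
  not_reach : ¬ Reach G c X (∑ v ∈ X, vertexWeight G c X v)
  reach : ∀ Y ⊂ X, ∀ c' : V → ℕ, Reach G c' Y (∑ v ∈ Y, vertexWeight G c' Y v)

variable {G} {c c' : V → ℕ} {X Y D A S : Finset V} {u v w x y z : V} {τ : ℝ}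

lemma Flagged.mono (h : Flagged G c Y v) (hYX : Y ⊆ X) : Flagged G c X v :=
  let ⟨u, h1, h2⟩ := h
  ⟨u, nbrs_mono hYX h1, h2⟩

lemma vertexWeight_sdiff_ge (hD : D ⊆ X)
    (h : ∀ d, 1 ≤ d → d ≤ #(nbrs G X v) → τ ≤ drop (c v) d (Flagged G c X v)) :
    vertexWeight G c X v + #(nbrs G D v) * τ ≤ vertexWeight G c (X \ D) v := by
  have h1 := card_nbrs_sdiff (G := G) (v := v) hD
  unfold vertexWeight
  rw [show #(nbrs G (X \ D) v) = #(nbrs G X v) - #(nbrs G D v) by omega]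
  exact weight_add_mul_le h (by omega) fun hf => hf.mono sdiff_subset

lemma vertexWeight_mono (hD : D ⊆ X) :
    vertexWeight G c X v ≤ vertexWeight G c (X \ D) v := by
  have := vertexWeight_sdiff_ge (G := G) (c := c) (v := v) hD (τ := 0) fun d _ _ => drop_nonneg
  simpa using this

namespace Critical

lemma take_lt (hX : Critical G c X) (hD : D ⊆ X) (hne : D.Nonempty) (hAD : A ⊆ D)
    (hA : IsCapForest G c A) (hno : ∀ a ∈ A, ∀ y ∈ X, G.Adj a y → y ∈ D) :
    18 * (#A : ℝ) + ∑ v ∈ X \ D, (vertexWeight G c (X \ D) v - vertexWeight G c X v) <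
      ∑ v ∈ D, vertexWeight G c X v :=
  take_lt_of_not_reach hX.not_reach (hX.reach _ (sdiff_ssubset hD hne) c) hD hAD hA hno

lemma take_lt' (hX : Critical G c X) (hD : D ⊆ X) (hne : D.Nonempty) (hAD : A ⊆ D)
    (hA : IsCapForest G c A) (hno : ∀ a ∈ A, ∀ y ∈ X, G.Adj a y → y ∈ D) :
    18 * (#A : ℝ) < ∑ v ∈ D, vertexWeight G c X v := by
  have h := hX.take_lt hD hne hAD hA hno
  have h2 : 0 ≤ ∑ v ∈ X \ D, (vertexWeight G c (X \ D) v - vertexWeight G c X v) :=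
    sum_nonneg fun v _ => sub_nonneg.2 (vertexWeight_mono hD)
  linarith

/-- If all drops are at least `τ`, then every edge leaving `D` gains `τ`. -/
lemma take_edges_lt (hX : Critical G c X) (hD : D ⊆ X) (hne : D.Nonempty) (hAD : A ⊆ D)
    (hA : IsCapForest G c A) (hno : ∀ a ∈ A, ∀ y ∈ X, G.Adj a y → y ∈ D)
    (hτ : ∀ v ∈ X, ∀ d, 1 ≤ d → d ≤ #(nbrs G X v) → τ ≤ drop (c v) d (Flagged G c X v)) :
    18 * (#A : ℝ) + τ * ((∑ a ∈ D, #(nbrs G (X \ D) a) : ℕ) : ℝ) <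
      ∑ v ∈ D, vertexWeight G c X v := by
  have h := hX.take_lt hD hne hAD hA hno
  have h2 := mul_sum_card_nbrs_le (G := G) (X := X) (D := D) (τ := τ)
    (g := vertexWeight G c X) (h := vertexWeight G c (X \ D)) fun v hv =>
      vertexWeight_sdiff_ge hD (hτ v (mem_sdiff.1 hv).1)
  linarith

/-- The gains of the neighbours do not make up for the deletion of `x`. -/
lemma delete_lt (hX : Critical G c X) (hx : x ∈ X) :
    ∑ v ∈ nbrs G X x, (vertexWeight G c (X \ {x}) v - vertexWeight G c X v) <
      vertexWeight G c X x := by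
  have hD : {x} ⊆ X := singleton_subset_iff.2 hx
  have h := hX.take_lt hD (singleton_nonempty x) (empty_subset _) isCapForest_empty (by simp)
  have h2 : ∑ v ∈ nbrs G X x, (vertexWeight G c (X \ {x}) v - vertexWeight G c X v) ≤
      ∑ v ∈ X \ {x}, (vertexWeight G c (X \ {x}) v - vertexWeight G c X v) :=
    sum_le_sum_of_subset_of_nonneg
      (fun v hv => by
        rw [mem_nbrs] at hv
        simp [hv.1, hv.2.ne'])
      fun v _ _ => sub_nonneg.2 (vertexWeight_mono hD)
  simp only [card_empty, Nat.cast_zero, mul_zero, zero_add, sum_singleton] at h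
  linarith

lemma card_nbrs_sdiff_singleton (hx : x ∈ X) (hv : v ∈ nbrs G X x) :
    #(nbrs G (X \ {x}) v) = #(nbrs G X v) - 1 := by
  have h := card_nbrs_sdiff (G := G) (v := v) (singleton_subset_iff.2 hx)
  rw [mem_nbrs] at hv
  have : nbrs G {x} v = {x} := by simp [nbrs, filter_singleton, hv.2.symm]
  rw [this, card_singleton] at h
  omega

lemma drop_le_gain (hx : x ∈ X) (hv : v ∈ nbrs G X x) :
    drop (c v) #(nbrs G X v) (Flagged G c X v) ≤
      vertexWeight G c (X \ {x}) v - vertexWeight G c X v := by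
  unfold vertexWeight drop
  rw [card_nbrs_sdiff_singleton hx hv]
  linarith [weight_flag_le (c := c v) (d := #(nbrs G X v) - 1)
    (Flagged.mono (G := G) (c := c) (v := v) · (sdiff_subset (s := X) (t := {x})))]

lemma card_mul_lt (hX : Critical G c X) (hx : x ∈ X)
    (hτ : ∀ v ∈ nbrs G X x, τ ≤ drop (c v) #(nbrs G X v) (Flagged G c X v)) :
    #(nbrs G X x) * τ < vertexWeight G c X x := by
  refine lt_of_le_of_lt ?_ (hX.delete_lt hx)
  rw [← nsmul_eq_mul]
  exact card_nsmul_le_sum _ _ _ fun v hv => (hτ v hv).trans (drop_le_gain hx hv)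

lemma gain_add_gain_lt (hX : Critical G c X) (hx : x ∈ X) (hne : y ≠ z)
    (h : nbrs G X x = {y, z}) :
    (vertexWeight G c (X \ {x}) y - vertexWeight G c X y) +
      (vertexWeight G c (X \ {x}) z - vertexWeight G c X z) < vertexWeight G c X x := by
  have := hX.delete_lt hx
  rwa [h, sum_pair hne] at this

lemma one_le_card_nbrs (hX : Critical G c X) (hx : x ∈ X) : 1 ≤ #(nbrs G X x) := by
  by_contra h
  have h0 : nbrs G X x = ∅ := card_eq_zero.1 (by omega)
  have h1 := hX.take_lt' (singleton_subset_iff.2 hx) (singleton_nonempty x) subset_rfl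
    isCapForest_singleton (by
      intro a ha y hy hadj
      rw [mem_singleton.1 ha] at hadj
      exact absurd (mem_nbrs.2 ⟨hy, hadj⟩) (h0 ▸ notMem_empty y))
  simp [vertexWeight, h0, weight_zero] at h1

/-- A vertex of minimum drop could be deleted if its weight were generic. -/
lemma small (hX : Critical G c X) (hx : x ∈ X) : Small (c x) #(nbrs G X x) := by
  by_contra h
  obtain ⟨v, hv, hmin⟩ := exists_min_image X
    (fun v => drop (c v) #(nbrs G X v) (Flagged G c X v)) ⟨x, hx⟩
  have hx1 := (weight_eq_mul_drop_and_drop_lt_one (b := Flagged G c X x)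
    (hX.one_le_card_nbrs hx) h).2
  have hvS : ¬ Small (c v) #(nbrs G X v) := fun hS => by
    have h1 := one_le_drop (b := Flagged G c X v) (hX.one_le_card_nbrs hv) hS
    linarith [hmin x hx]
  have h2 := hX.card_mul_lt hv fun u hu => hmin u (nbrs_subset hu)
  have h3 := (weight_eq_mul_drop_and_drop_lt_one (b := Flagged G c X v)
    (hX.one_le_card_nbrs hv) hvS).1
  unfold vertexWeight at h2
  linarith

lemma one_le_drop (hX : Critical G c X) (hx : x ∈ X) :
    ∀ d, 1 ≤ d → d ≤ #(nbrs G X x) → 1 ≤ drop (c x) d (Flagged G c X x) :=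
  fun _ h1 h2 => LinearForestBound.one_le_drop h1 ((hX.small hx).mono h2)

lemma one_le_gain (hX : Critical G c X) (hx : x ∈ X) (hv : v ∈ nbrs G X x) :
    1 ≤ vertexWeight G c (X \ {x}) v - vertexWeight G c X v :=
  (hX.one_le_drop (nbrs_subset hv) _ (hX.one_le_card_nbrs (nbrs_subset hv)) le_rfl).trans
    (drop_le_gain hx hv)

end Critical

end Critical

/-! ### Vertices of capacity `0` -/

section Zero

variable {V : Type*} [DecidableEq V] {G : SimpleGraph V} [DecidableRel G.Adj]
variable {c c' : V → ℕ} {X Y D A S : Finset V} {u v w x y z : V} {τ : ℝ}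

namespace Critical

lemma card_nbrs_of_zero (hX : Critical G c X) (hx : x ∈ X) (hc : c x = 0) :
    #(nbrs G X x) = 2 := by
  have h1 := hX.one_le_card_nbrs hx
  have h3 := (hX.small hx).1 hc
  by_contra hne
  obtain h | h : #(nbrs G X x) = 1 ∨ #(nbrs G X x) = 3 := by omega
  · obtain ⟨z, hz⟩ := card_eq_one.1 h
    have hz' : z ∈ nbrs G X x := by simp [hz]
    rw [mem_nbrs] at hz'
    have h4 := hX.take_lt' (D := {x, z}) (A := {x})
      (insert_subset hx (singleton_subset_iff.2 hz'.1)) (by simp) (by simp)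
      isCapForest_singleton (by
        intro a ha y hy hadj
        rw [mem_singleton.1 ha] at hadj
        have : y ∈ nbrs G X x := mem_nbrs.2 ⟨hy, hadj⟩
        rw [hz] at this
        exact mem_insert_of_mem this)
    rw [sum_pair hz'.2.ne] at h4
    have h5 : vertexWeight G c X z ≤ 11 :=
      weight_flagged_le (hX.one_le_card_nbrs hz'.1) ⟨x, mem_nbrs.2 ⟨hx, hz'.2.symm⟩, hc⟩
    have h6 : vertexWeight G c X x = 7 := by simp [vertexWeight, h, hc, weight]
    simp only [card_singleton, Nat.cast_one] at h4
    linarith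
  · have h4 := hX.card_mul_lt hx fun v hv => hX.one_le_drop (nbrs_subset hv) _
      (hX.one_le_card_nbrs (nbrs_subset hv)) le_rfl
    norm_num [vertexWeight, h, hc, weight] at h4

lemma vertexWeight_of_zero (hX : Critical G c X) (hx : x ∈ X) (hc : c x = 0) :
    vertexWeight G c X x = 4 := by
  norm_num [vertexWeight, hX.card_nbrs_of_zero hx hc, hc, weight]

/-- A vertex of capacity `0` weighs `4`, and its other neighbour gains at least `1` from its
deletion. -/
lemma gain_lt_three (hX : Critical G c X) (hx : x ∈ X) (hc : c x = 0) (hy : y ∈ nbrs G X x) :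
    vertexWeight G c (X \ {x}) y - vertexWeight G c X y < 3 := by
  obtain ⟨z, hzy, hz⟩ := exists_other (hX.card_nbrs_of_zero hx hc) hy
  have h1 := hX.gain_add_gain_lt hx hzy.symm hz
  have h2 := hX.one_le_gain hx (v := z) (by simp [hz])
  rw [hX.vertexWeight_of_zero hx hc] at h1
  linarith

lemma nbr_ne_zero (hX : Critical G c X) (hx : x ∈ X) (hc : c x = 0) (hy : y ∈ nbrs G X x) :
    c y ≠ 0 := by
  intro hcy
  have h1 := hX.gain_lt_three hx hc hy
  have h2 := drop_le_gain (c := c) hx hy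
  rw [hX.card_nbrs_of_zero (nbrs_subset hy) hcy] at h2
  norm_num [drop, weight, hcy] at h2
  linarith

/-- A neighbour `y` of a vertex of capacity `0` that gains little from the deletion of that vertex
has degree `3` and a second neighbour of capacity `0`, or a weight that exceeds its degree only
slightly. The comparison with the degree matters since a deletion of `y` gains at least `1` for
each of its edges. -/
lemma nbr_of_zero (hX : Critical G c X) (hx : x ∈ X) (hc : c x = 0) (hy : y ∈ nbrs G X x) :
    (vertexWeight G c X y ≤ #(nbrs G X y) + 16 / 5) ∨
      (2 ≤ c y ∧ #(nbrs G X y) = 3 ∧ ∃ u ∈ nbrs G X y, u ≠ x ∧ c u = 0) := by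
  have hc0 := hX.nbr_ne_zero hx hc hy
  have hyX := mem_nbrs.1 hy
  have hxy : x ∈ nbrs G X y := mem_nbrs.2 ⟨hx, hyX.2.symm⟩
  have hfl : Flagged G c X y := ⟨x, hxy, hc⟩
  have h1 := hX.gain_lt_three hx hc hy
  have hd := lt_of_le_of_lt (drop_le_gain (c := c) hx hy) h1
  obtain ⟨-, hs1, hs2⟩ := hX.small hyX.1
  have hpos := hX.one_le_card_nbrs hyX.1
  unfold vertexWeight at h1 ⊢
  rw [card_nbrs_sdiff_singleton hx hy] at h1
  by_cases hc1 : c y = 1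
  · left
    have := hs1 hc1
    rw [hc1] at hd ⊢
    generalize #(nbrs G X y) = d at *
    interval_cases d <;> norm_num [drop, weight, hfl] at hd <;> norm_num [weight]
  -- If the flag of `y` disappears together with `x`, then `y` gains at least `3`.
  have hother : #(nbrs G X y) = 2 ∨ #(nbrs G X y) = 3 → ∃ u ∈ nbrs G X y, u ≠ x ∧ c u = 0 := by
    intro h23
    by_contra hno
    push Not at hno
    have hnf : ¬ Flagged G c (X \ {x}) y := by
      rintro ⟨u, hu, hcu⟩
      rw [mem_nbrs, mem_sdiff, mem_singleton] at hu
      exact hno u (mem_nbrs.2 ⟨hu.1.1, hu.2⟩) hu.1.2 hcu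
    rcases h23 with h | h <;> norm_num [h, weight, hfl, hnf, hc0, hc1] at h1
  obtain h | h | h | h : #(nbrs G X y) = 1 ∨ #(nbrs G X y) = 2 ∨ #(nbrs G X y) = 3 ∨
      4 ≤ #(nbrs G X y) := by omega
  · norm_num [h, drop, weight, hfl, hc0] at hd
  · obtain ⟨u, hu, hux, hcu⟩ := hother (Or.inl h)
    obtain ⟨u', hu', heq⟩ := exists_other h hxy
    have huu : u = u' := by
      rw [heq, mem_insert, mem_singleton] at hu
      exact hu.resolve_left hux
    subst huu
    have huX := mem_nbrs.1 hu
    have h4 := hX.take_lt' (D := {x, u, y}) (A := {y})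
      (insert_subset hx (insert_subset huX.1 (singleton_subset_iff.2 hyX.1))) (by simp) (by simp)
      isCapForest_singleton (by
        intro a ha t ht hadj
        rw [mem_singleton.1 ha] at hadj
        have : t ∈ nbrs G X y := mem_nbrs.2 ⟨ht, hadj⟩
        rw [heq] at this
        simp only [mem_insert, mem_singleton] at this ⊢
        tauto)
    rw [sum_insert (by simp [hux.symm, hyX.2.ne]), sum_pair huX.2.ne',
      hX.vertexWeight_of_zero hx hc, hX.vertexWeight_of_zero huX.1 hcu] at h4
    norm_num [vertexWeight, h, weight, hfl, hc0, hc1] at h4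
  · exact Or.inr ⟨by omega, h, hother (Or.inr h)⟩
  · left
    generalize #(nbrs G X y) = d at *
    interval_cases d <;> norm_num [weight, hc0, hc1]

/-- If both neighbours `y` and `w` of a vertex of capacity `0` have degree `3` and a second
neighbour of capacity `0`, and are adjacent, then `y` and `w` go into the forest. They weigh `9`
each, and the at most four deleted vertices around them `4` each. -/
lemma not_adj_of_zero (hX : Critical G c X) (hx : x ∈ X) (hc : c x = 0)
    (hy : y ∈ nbrs G X x) (hw : w ∈ nbrs G X x) (hyw : G.Adj y w)
    (hy2 : 2 ≤ c y) (hy3 : #(nbrs G X y) = 3) (hyu : ∃ u ∈ nbrs G X y, u ≠ x ∧ c u = 0)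
    (hw2 : 2 ≤ c w) (hw3 : #(nbrs G X w) = 3) (hwu : ∃ u ∈ nbrs G X w, u ≠ x ∧ c u = 0) :
    False := by
  -- Apart from `y` and `w` themselves, both have only neighbours of capacity `0`.
  have key : ∀ {a b : V}, a ∈ nbrs G X x → b ∈ nbrs G X x → G.Adj a b → 2 ≤ c b →
      #(nbrs G X a) = 3 → (∃ u ∈ nbrs G X a, u ≠ x ∧ c u = 0) →
      #((nbrs G X a).erase b) = 2 ∧ ∀ t ∈ (nbrs G X a).erase b, t ∈ X ∧ c t = 0 := by
    rintro a b ha hb hab hb2 ha3 ⟨u, hu, hux, hcu⟩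
    have haX := mem_nbrs.1 ha
    have hbm : b ∈ nbrs G X a := mem_nbrs.2 ⟨(mem_nbrs.1 hb).1, hab⟩
    have hcard : #((nbrs G X a).erase b) = 2 := by rw [card_erase_of_mem hbm, ha3]
    refine ⟨hcard, ?_⟩
    have hsub : ({x, u} : Finset V) ⊆ (nbrs G X a).erase b := by
      refine insert_subset (mem_erase.2 ⟨?_, mem_nbrs.2 ⟨hx, haX.2.symm⟩⟩)
        (singleton_subset_iff.2 (mem_erase.2 ⟨?_, hu⟩))
      · rintro rfl
        omega
      · rintro rfl
        omega
    have heq := eq_of_subset_of_card_le hsub (by rw [hcard, card_pair hux.symm])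
    intro t ht
    refine ⟨nbrs_subset (mem_of_mem_erase ht), ?_⟩
    rw [← heq, mem_insert, mem_singleton] at ht
    rcases ht with rfl | rfl
    · exact hc
    · exact hcu
  obtain ⟨hc1, hz1⟩ := key hy hw hyw hw2 hy3 hyu
  obtain ⟨hc2, hz2⟩ := key hw hy hyw.symm hy2 hw3 hwu
  have hyX := (mem_nbrs.1 hy).1
  have hwX := (mem_nbrs.1 hw).1
  have hsub : ({y, w} : Finset V) ⊆ nbrs G X y ∪ nbrs G X w := by
    refine insert_subset (mem_union_right _ (mem_nbrs.2 ⟨hyX, hyw.symm⟩))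
      (singleton_subset_iff.2 (mem_union_left _ (mem_nbrs.2 ⟨hwX, hyw⟩)))
  have h := hX.take_lt' (D := nbrs G X y ∪ nbrs G X w) (A := {y, w})
    (union_subset nbrs_subset nbrs_subset) ⟨y, hsub (by simp)⟩ hsub
    (isCapForest_pair (by omega) (by omega)) (by
      intro a ha t ht hadj
      rw [mem_insert, mem_singleton] at ha
      rcases ha with rfl | rfl
      · exact mem_union_left _ (mem_nbrs.2 ⟨ht, hadj⟩)
      · exact mem_union_right _ (mem_nbrs.2 ⟨ht, hadj⟩))
  have hrest : (nbrs G X y ∪ nbrs G X w) \ {y, w} ⊆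
      (nbrs G X y).erase w ∪ (nbrs G X w).erase y := by
    intro t ht
    simp only [mem_sdiff, mem_union, mem_insert, mem_singleton, not_or, mem_erase] at ht ⊢
    tauto
  have hle : ∑ t ∈ (nbrs G X y ∪ nbrs G X w) \ {y, w}, vertexWeight G c X t ≤ 16 := by
    have h1 : ∀ t ∈ (nbrs G X y ∪ nbrs G X w) \ {y, w}, vertexWeight G c X t = 4 := by
      intro t ht
      rcases mem_union.1 (hrest ht) with h' | h'
      · exact hX.vertexWeight_of_zero (hz1 t h').1 (hz1 t h').2
      · exact hX.vertexWeight_of_zero (hz2 t h').1 (hz2 t h').2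
    rw [sum_congr rfl h1, sum_const, nsmul_eq_mul]
    have h2 := (card_le_card hrest).trans (card_union_le _ _)
    rw [hc1, hc2] at h2
    have h3 : (#((nbrs G X y ∪ nbrs G X w) \ {y, w}) : ℝ) ≤ 4 := by exact_mod_cast h2
    linarith
  have h9 : ∀ {a : V}, 2 ≤ c a → #(nbrs G X a) = 3 → vertexWeight G c X a = 9 := by
    intro a ha hb
    norm_num [vertexWeight, weight, hb, show c a ≠ 0 by omega, show c a ≠ 1 by omega]
  rw [← sum_sdiff hsub, sum_pair hyw.ne, h9 hy2 hy3, h9 hw2 hw3, card_pair hyw.ne] at h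
  norm_num at h
  linarith

/-- There is no vertex `x` of capacity `0`: putting it into the forest and deleting its neighbours
`y` and `w` yields `18` and `1` for every further edge at `y` or `w`, which suffices unless `y` and
`w` are adjacent and both have degree `3`. -/
theorem ne_zero (hX : Critical G c X) (hx : x ∈ X) : c x ≠ 0 := by
  intro hc
  obtain ⟨y, w, hyw, hnb⟩ := card_eq_two.1 (hX.card_nbrs_of_zero hx hc)
  have hy : y ∈ nbrs G X x := by simp [hnb]
  have hw : w ∈ nbrs G X x := by simp [hnb]
  have hyX := mem_nbrs.1 hy
  have hwX := mem_nbrs.1 hw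
  have hD : ({x, y, w} : Finset V) ⊆ X :=
    insert_subset hx (insert_subset hyX.1 (singleton_subset_iff.2 hwX.1))
  have h := hX.take_edges_lt (A := {x}) hD (by simp) (by simp) isCapForest_singleton (by
      intro a ha t ht hadj
      rw [mem_singleton.1 ha] at hadj
      have : t ∈ nbrs G X x := mem_nbrs.2 ⟨ht, hadj⟩
      rw [hnb] at this
      exact mem_insert_of_mem this)
    fun v hv => hX.one_le_drop hv
  have hxyw : x ∉ ({y, w} : Finset V) := by simp [hyX.2.ne, hwX.2.ne]
  rw [sum_insert hxyw, sum_insert hxyw, sum_pair hyw, sum_pair hyw,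
    hX.vertexWeight_of_zero hx hc, card_singleton] at h
  have hdy := card_nbrs_sdiff (G := G) (v := y) hD
  have hdw := card_nbrs_sdiff (G := G) (v := w) hD
  have h1 := hX.nbr_of_zero hx hc hy
  have h2 := hX.nbr_of_zero hx hc hw
  have h9 : ∀ {a : V}, 2 ≤ c a → #(nbrs G X a) = 3 → vertexWeight G c X a = 9 := by
    intro a ha hb
    norm_num [vertexWeight, weight, hb, show c a ≠ 0 by omega, show c a ≠ 1 by omega]
  have h6 : ∀ {a : V}, (vertexWeight G c X a ≤ #(nbrs G X a) + 16 / 5) ∨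
      (2 ≤ c a ∧ #(nbrs G X a) = 3 ∧ ∃ u ∈ nbrs G X a, u ≠ x ∧ c u = 0) →
      vertexWeight G c X a ≤ #(nbrs G X a) + 6 := by
    rintro a (ha | ⟨ha, hb, -⟩)
    · linarith
    · rw [h9 ha hb, hb]
      norm_num
  by_cases hadj : G.Adj y w
  · have hny : #(nbrs G {x, y, w} y) ≤ 2 := by
      have : nbrs G {x, y, w} y ⊆ {x, w} := fun t ht => by
        rw [mem_nbrs] at ht
        have := ht.2.ne'
        simp_all
      exact (card_le_card this).trans card_le_two
    have hnw : #(nbrs G {x, y, w} w) ≤ 2 := by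
      have : nbrs G {x, y, w} w ⊆ {x, y} := fun t ht => by
        rw [mem_nbrs] at ht
        have := ht.2.ne'
        simp_all
      exact (card_le_card this).trans card_le_two
    have h3 : #(nbrs G X y) + #(nbrs G X w) ≤ #(nbrs G (X \ {x, y, w}) x) +
        (#(nbrs G (X \ {x, y, w}) y) + #(nbrs G (X \ {x, y, w}) w)) + 4 := by omega
    have h4 : (#(nbrs G X y) : ℝ) + #(nbrs G X w) ≤ ((#(nbrs G (X \ {x, y, w}) x) +
        (#(nbrs G (X \ {x, y, w}) y) + #(nbrs G (X \ {x, y, w}) w)) : ℕ) : ℝ) + 4 := by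
      exact_mod_cast h3
    norm_num at h
    push_cast at h4
    rcases h1 with h1 | ⟨h1, h1', h1''⟩
    · linarith [h6 h2]
    rcases h2 with h2 | ⟨h2, h2', h2''⟩
    · linarith [h6 (Or.inr ⟨h1, h1', h1''⟩)]
    exact hX.not_adj_of_zero hx hc hy hw hadj h1 h1' h1'' h2 h2' h2''
  · have hny : #(nbrs G {x, y, w} y) ≤ 1 := by
      have : nbrs G {x, y, w} y ⊆ {x} := fun t ht => by
        rw [mem_nbrs] at ht
        have := ht.2.ne'
        rcases mem_insert.1 ht.1 with rfl | h'
        · simp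
        · rcases mem_insert.1 h' with rfl | h'
          · exact absurd rfl this
          · exact absurd (mem_singleton.1 h' ▸ ht.2) hadj
      exact (card_le_card this).trans (by simp)
    have hnw : #(nbrs G {x, y, w} w) ≤ 1 := by
      have : nbrs G {x, y, w} w ⊆ {x} := fun t ht => by
        rw [mem_nbrs] at ht
        have := ht.2.ne'
        rcases mem_insert.1 ht.1 with rfl | h'
        · simp
        · rcases mem_insert.1 h' with rfl | h'
          · exact absurd ht.2.symm hadj
          · exact absurd (mem_singleton.1 h') this
      exact (card_le_card this).trans (by simp)
    have h3 : #(nbrs G X y) + #(nbrs G X w) ≤ #(nbrs G (X \ {x, y, w}) x) +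
        (#(nbrs G (X \ {x, y, w}) y) + #(nbrs G (X \ {x, y, w}) w)) + 2 := by omega
    have h4 : (#(nbrs G X y) : ℝ) + #(nbrs G X w) ≤ ((#(nbrs G (X \ {x, y, w}) x) +
        (#(nbrs G (X \ {x, y, w}) y) + #(nbrs G (X \ {x, y, w}) w)) : ℕ) : ℝ) + 2 := by
      exact_mod_cast h3
    norm_num at h
    push_cast at h4
    linarith [h6 h1, h6 h2]

end Critical

end Zero

/-! ### Positive capacities -/

section Positive

variable {V : Type*} [DecidableEq V] {G : SimpleGraph V} [DecidableRel G.Adj]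
variable {c c' : V → ℕ} {X Y D A S : Finset V} {u v w x y z : V} {τ : ℝ}

namespace Critical

lemma not_flagged (hX : Critical G c X) (hY : Y ⊆ X) : ¬ Flagged G c Y v := by
  rintro ⟨u, hu, hcu⟩
  exact hX.ne_zero (hY (nbrs_subset hu)) hcu

/-- Deleting vertices in order of increasing drop bounds the degrees. The successive thresholds
`6 / 5`, `9 / 5` and `2` are the drops for capacity `2` and degree `5` (or capacity `1` and
degree `4`), for capacity `2` and degree `4`, and for capacity `1` and degree `3`. -/
lemma cap_degree (hX : Critical G c X) (hx : x ∈ X) :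
    (2 ≤ c x ∧ #(nbrs G X x) ≤ 3) ∨ (c x = 1 ∧ #(nbrs G X x) ≤ 2) := by
  have hpos := fun v hv => hX.one_le_card_nbrs (x := v) hv
  have step1 : ∀ v ∈ X, 6 / 5 ≤ drop (c v) #(nbrs G X v) (Flagged G c X v) := by
    intro v hv
    have h0 := hX.ne_zero hv
    have hf := hX.not_flagged (v := v) subset_rfl
    obtain ⟨-, h1, h2⟩ := hX.small hv
    have h3 := hpos v hv
    by_cases hc1 : c v = 1
    · have := h1 hc1
      generalize #(nbrs G X v) = d at *
      interval_cases d <;> norm_num [drop, weight, hf, hc1]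
    · generalize #(nbrs G X v) = d at *
      interval_cases d <;> norm_num [drop, weight, hf, h0, hc1]
  have step2 : ∀ v ∈ X, (2 ≤ c v ∧ #(nbrs G X v) ≤ 4) ∨ (c v = 1 ∧ #(nbrs G X v) ≤ 3) := by
    intro v hv
    have h0 := hX.ne_zero hv
    obtain ⟨-, h1, h2⟩ := hX.small hv
    have h3 := hX.card_mul_lt hv fun u hu => step1 u (nbrs_subset hu)
    by_cases hc1 : c v = 1
    · refine Or.inr ⟨hc1, ?_⟩
      by_contra hcon
      have h4 : #(nbrs G X v) = 4 := by have := h1 hc1; omega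
      norm_num [vertexWeight, weight, h4, hc1] at h3
    · refine Or.inl ⟨by omega, ?_⟩
      by_contra hcon
      have h4 : #(nbrs G X v) = 5 := by omega
      norm_num [vertexWeight, weight, h4, hc1, h0] at h3
  have step3 : ∀ v ∈ X, 9 / 5 ≤ drop (c v) #(nbrs G X v) (Flagged G c X v) := by
    intro v hv
    have hf := hX.not_flagged (v := v) subset_rfl
    have h3 := hpos v hv
    rcases step2 v hv with ⟨h1, h2⟩ | ⟨h1, h2⟩
    · have h0 : c v ≠ 0 := by omega
      have h1' : c v ≠ 1 := by omega
      generalize #(nbrs G X v) = d at *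
      interval_cases d <;> norm_num [drop, weight, hf, h0, h1']
    · generalize #(nbrs G X v) = d at *
      interval_cases d <;> norm_num [drop, weight, hf, h1]
  have step4 : ∀ v ∈ X, (2 ≤ c v ∧ #(nbrs G X v) ≤ 3) ∨ (c v = 1 ∧ #(nbrs G X v) ≤ 3) := by
    intro v hv
    rcases step2 v hv with ⟨h1, h2⟩ | h
    · refine Or.inl ⟨h1, ?_⟩
      have h3 := hX.card_mul_lt hv fun u hu => step3 u (nbrs_subset hu)
      by_contra hcon
      have h4 : #(nbrs G X v) = 4 := by omega
      norm_num [vertexWeight, weight, h4, show c v ≠ 0 by omega, show c v ≠ 1 by omega] at h3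
    · exact Or.inr h
  have step5 : ∀ v ∈ X, 2 ≤ drop (c v) #(nbrs G X v) (Flagged G c X v) := by
    intro v hv
    have hf := hX.not_flagged (v := v) subset_rfl
    have h3 := hpos v hv
    rcases step4 v hv with ⟨h1, h2⟩ | ⟨h1, h2⟩
    · have h0 : c v ≠ 0 := by omega
      have h1' : c v ≠ 1 := by omega
      generalize #(nbrs G X v) = d at *
      interval_cases d <;> norm_num [drop, weight, hf, h0, h1']
    · generalize #(nbrs G X v) = d at *
      interval_cases d <;> norm_num [drop, weight, hf, h1]
  rcases step4 x hx with h | ⟨h1, h2⟩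
  · exact Or.inl h
  · refine Or.inr ⟨h1, ?_⟩
    have h3 := hX.card_mul_lt hx fun u hu => step5 u (nbrs_subset hu)
    by_contra hcon
    have h4 : #(nbrs G X x) = 3 := by omega
    norm_num [vertexWeight, weight, h4, h1] at h3

lemma two_le_drop (hX : Critical G c X) (hx : x ∈ X) (d : ℕ) (hd : 1 ≤ d)
    (hd' : d ≤ #(nbrs G X x)) : 2 ≤ drop (c x) d (Flagged G c X x) := by
  have hf := hX.not_flagged (v := x) subset_rfl
  rcases hX.cap_degree hx with ⟨h1, h2⟩ | ⟨h1, h2⟩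
  · have h0 : c x ≠ 0 := by omega
    have h1' : c x ≠ 1 := by omega
    have hd3 := hd'.trans h2
    interval_cases d <;> norm_num [drop, weight, hf, h0, h1']
  · have hd3 := hd'.trans h2
    interval_cases d <;> norm_num [drop, weight, hf, h1]

/-- Putting `e` into the forest and lowering the capacity of its only remaining neighbour `v`
to `1`. -/
lemma absorb_lt {e : V} (hX : Critical G c X) (hD : D ⊆ X) (he : e ∈ D) (hv : v ∈ X \ D)
    (hcv : 2 ≤ c v) (hev : ∀ y ∈ X, G.Adj e y → y = v ∨ y ∈ D) :
    18 + (weight 1 #(nbrs G (X \ D) v) False - vertexWeight G c X v) <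
      ∑ t ∈ D, vertexWeight G c X t := by
  set c' := Function.update c v 1 with hc'
  have hne : ∀ t ≠ v, c' t = c t := fun t ht => by rw [hc', Function.update_of_ne ht]
  have hcv' : c' v = 1 := by rw [hc', Function.update_self]
  have hfl : ∀ t, ¬ Flagged G c' (X \ D) t := by
    rintro t ⟨u, hu, hcu⟩
    by_cases huv : u = v
    · rw [huv, hcv'] at hcu
      exact one_ne_zero hcu
    · rw [hne u huv] at hcu
      exact hX.ne_zero (sdiff_subset (nbrs_subset hu)) hcu
  have h := absorb_lt_of_not_reach (v := v) hX.not_reach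
    (hX.reach _ (sdiff_ssubset hD ⟨e, he⟩) c') hD he
    (Nat.one_le_iff_ne_zero.2 (hX.ne_zero (hD he))) hev (by omega)
    (fun t ht => (hne t ht).le)
  have h2 := single_le_sum
    (f := fun t => vertexWeight G c' (X \ D) t - vertexWeight G c X t + if t = v then
      vertexWeight G c X v - weight 1 #(nbrs G (X \ D) v) False else 0)
    (s := X \ D) (a := v) (fun t _ => by
      by_cases htv : t = v
      · subst htv
        simp [vertexWeight, hcv', hfl]
      · simp only [htv, if_false, add_zero, sub_nonneg]
        have h1 := card_nbrs_sdiff (G := G) (v := t) hD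
        unfold vertexWeight
        rw [hne t htv, show #(nbrs G (X \ D) t) = #(nbrs G X t) - #(nbrs G D t) by omega]
        exact weight_mono (by omega) fun hf => absurd hf (hfl t)) hv
  rw [sum_add_distrib, sum_ite_eq' (X \ D) v, if_pos hv] at h2
  simp only [if_true, vertexWeight, hcv', hfl] at h2
  simp only [vertexWeight, hfl] at h ⊢
  linarith

/-- There is no end `x`: with neighbour `v`, both go into the forest if `v` is an end or has
capacity `1`, a second neighbour of `v` being deleted, and otherwise `x` is absorbed into `v`. -/
lemma two_le_card_nbrs (hX : Critical G c X) (hx : x ∈ X) : 2 ≤ #(nbrs G X x) := by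
  by_contra hcon
  have h1 : #(nbrs G X x) = 1 := by have := hX.one_le_card_nbrs hx; omega
  have hf := fun v => hX.not_flagged (v := v) subset_rfl
  have hw : vertexWeight G c X x = 14 := by
    norm_num [vertexWeight, weight, h1, hf, hX.ne_zero hx]
  obtain ⟨v, hv⟩ := card_eq_one.1 h1
  have hvm : v ∈ nbrs G X x := by simp [hv]
  have hvX := mem_nbrs.1 hvm
  have hx1 : ∀ t ∈ X, G.Adj x t → t = v := fun t ht hadj => by
    have : t ∈ nbrs G X x := mem_nbrs.2 ⟨ht, hadj⟩
    rwa [hv, mem_singleton] at this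
  have hxv : x ∈ nbrs G X v := mem_nbrs.2 ⟨hx, hvX.2.symm⟩
  have hpair : IsCapForest G c {x, v} := isCapForest_pair
    (Nat.one_le_iff_ne_zero.2 (hX.ne_zero hx)) (Nat.one_le_iff_ne_zero.2 (hX.ne_zero hvX.1))
  have hv1 := hX.one_le_card_nbrs hvX.1
  by_cases hd1 : #(nbrs G X v) = 1
  · have h := hX.take_lt' (D := {x, v}) (insert_subset hx (singleton_subset_iff.2 hvX.1))
      (by simp) subset_rfl hpair (by
        intro a ha t ht hadj
        rw [mem_insert, mem_singleton] at ha
        rcases ha with rfl | rfl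
        · simp [hx1 t ht hadj]
        · obtain ⟨x', hx'⟩ := card_eq_one.1 hd1
          have ht : t ∈ nbrs G X a := mem_nbrs.2 ⟨ht, hadj⟩
          rw [hx', mem_singleton] at ht hxv
          simp [ht, hxv])
    rw [sum_pair hvX.2.ne, hw, card_pair hvX.2.ne] at h
    norm_num [vertexWeight, weight, hd1, hf, hX.ne_zero hvX.1] at h
  rcases hX.cap_degree hvX.1 with ⟨hc2, hd3⟩ | ⟨hc1, hd2⟩
  · have h := hX.absorb_lt (D := {x}) (singleton_subset_iff.2 hx) (mem_singleton_self x)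
      (v := v) (by simp [hvX.1, hvX.2.ne']) hc2 (fun t ht hadj => Or.inl (hx1 t ht hadj))
    rw [card_nbrs_sdiff_singleton hx hvm, sum_singleton, hw] at h
    unfold vertexWeight at h
    have h0 : c v ≠ 0 := by omega
    have h1' : c v ≠ 1 := by omega
    obtain h2 | h2 : #(nbrs G X v) = 2 ∨ #(nbrs G X v) = 3 := by omega
    all_goals norm_num [weight, h2, hf, h0, h1'] at h
  · have h2 : #(nbrs G X v) = 2 := by omega
    obtain ⟨z, hzx, hz⟩ := exists_other h2 hxv
    have hzm : z ∈ nbrs G X v := by simp [hz]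
    have hzX := mem_nbrs.1 hzm
    have h := hX.take_lt' (D := {x, v, z}) (A := {x, v})
      (insert_subset hx (insert_subset hvX.1 (singleton_subset_iff.2 hzX.1)))
      (by simp) (by intro t; simp only [mem_insert, mem_singleton]; tauto) hpair (by
        intro a ha t ht hadj
        rw [mem_insert, mem_singleton] at ha
        rcases ha with rfl | rfl
        · simp [hx1 t ht hadj]
        · have ht : t ∈ nbrs G X a := mem_nbrs.2 ⟨ht, hadj⟩
          rw [hz, mem_insert, mem_singleton] at ht
          simp only [mem_insert, mem_singleton]
          tauto)
    rw [sum_insert (by simp [hvX.2.ne, hzx.symm]), sum_pair hzX.2.ne, hw,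
      card_pair hvX.2.ne] at h
    have h3 : vertexWeight G c X v = 8 := by norm_num [vertexWeight, weight, h2, hc1]
    have h4 : vertexWeight G c X z ≤ 14 := by
      have hz1 := hX.one_le_card_nbrs hzX.1
      have hz0 := hX.ne_zero hzX.1
      unfold vertexWeight
      rcases hX.cap_degree hzX.1 with ⟨h5, h6⟩ | ⟨h5, h6⟩
      all_goals
        generalize #(nbrs G X z) = d at *
        have h7 : 2 ≤ c z → c z ≠ 1 := by omega
        interval_cases d <;> norm_num [weight, hf, hz0, h5, h7]
    norm_num at h
    linarith

lemma vertexWeight_of_one (hX : Critical G c X) (hx : x ∈ X) (hc : c x = 1) :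
    #(nbrs G X x) = 2 ∧ vertexWeight G c X x = 8 := by
  have h2 : #(nbrs G X x) = 2 := by
    have := hX.two_le_card_nbrs hx
    rcases hX.cap_degree hx with h | h <;> omega
  exact ⟨h2, by norm_num [vertexWeight, weight, h2, hc]⟩

lemma vertexWeight_of_two_le (hX : Critical G c X) (hx : x ∈ X) (hc : 2 ≤ c x) :
    (#(nbrs G X x) = 2 ∧ vertexWeight G c X x = 12) ∨
      (#(nbrs G X x) = 3 ∧ vertexWeight G c X x = 9) := by
  have hf := hX.not_flagged (v := x) subset_rfl
  have h2 := hX.two_le_card_nbrs hx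
  have h0 : c x ≠ 0 := by omega
  have h1 : c x ≠ 1 := by omega
  obtain h | h : #(nbrs G X x) = 2 ∨ #(nbrs G X x) = 3 := by
    rcases hX.cap_degree hx with h | h <;> omega
  · exact Or.inl ⟨h, by norm_num [vertexWeight, weight, h, hf, h0, h1]⟩
  · exact Or.inr ⟨h, by norm_num [vertexWeight, weight, h, h0, h1]⟩

lemma two_le_gain (hX : Critical G c X) (hx : x ∈ X) (hv : v ∈ nbrs G X x) :
    2 ≤ vertexWeight G c (X \ {x}) v - vertexWeight G c X v :=
  (hX.two_le_drop (nbrs_subset hv) _ (hX.one_le_card_nbrs (nbrs_subset hv)) le_rfl).trans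
    (drop_le_gain hx hv)

lemma six_le_gain (hX : Critical G c X) (hx : x ∈ X) (hv : v ∈ nbrs G X x) (hc : c v = 1) :
    6 ≤ vertexWeight G c (X \ {x}) v - vertexWeight G c X v := by
  refine le_trans ?_ (drop_le_gain hx hv)
  have hf := hX.not_flagged (v := v) subset_rfl
  norm_num [drop, weight, (hX.vertexWeight_of_one (nbrs_subset hv) hc).1, hf, hc]

/-- The neighbours of a vertex of capacity `1` have capacity and degree `2`. -/
lemma nbr_of_one (hX : Critical G c X) (hx : x ∈ X) (hc : c x = 1) (hy : y ∈ nbrs G X x) :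
    2 ≤ c y ∧ #(nbrs G X y) = 2 ∧ vertexWeight G c X y = 12 := by
  have hyX := mem_nbrs.1 hy
  obtain ⟨hd, hw⟩ := hX.vertexWeight_of_one hx hc
  by_cases hcy : c y = 1
  · obtain ⟨z, hzy, hz⟩ := exists_other hd hy
    have h1 := hX.gain_add_gain_lt hx hzy.symm hz
    linarith [hX.six_le_gain hx hy hcy, hX.two_le_gain hx (v := z) (by simp [hz])]
  have hc2 : 2 ≤ c y := by have := hX.ne_zero hyX.1; omega
  rcases hX.vertexWeight_of_two_le hyX.1 hc2 with h | ⟨h3, h9⟩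
  · exact ⟨hc2, h⟩
  · exfalso
    have h1 := hX.delete_lt hyX.1
    have hxm : x ∈ nbrs G X y := mem_nbrs.2 ⟨hx, hyX.2.symm⟩
    rw [← add_sum_erase _ _ hxm] at h1
    have h2 : (#((nbrs G X y).erase x) : ℕ) • (2 : ℝ) ≤ ∑ v ∈ (nbrs G X y).erase x,
        (vertexWeight G c (X \ {y}) v - vertexWeight G c X v) :=
      card_nsmul_le_sum _ _ _ fun v hv => hX.two_le_gain hyX.1 (mem_of_mem_erase hv)
    rw [card_erase_of_mem hxm, h3, nsmul_eq_mul, show ((3 - 1 : ℕ) : ℝ) = 2 by norm_num] at h2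
    linarith [hX.six_le_gain hyX.1 hxm hc]

/-- There is no vertex `x` of capacity `1`. Its neighbours `y` and `z` have degree `2`, and the
exchange to be made depends on the second neighbours of `y` and `z`. -/
theorem ne_one (hX : Critical G c X) (hx : x ∈ X) : c x ≠ 1 := by
  intro hc
  obtain ⟨hd, hw⟩ := hX.vertexWeight_of_one hx hc
  obtain ⟨y, z, hyz, hnb⟩ := card_eq_two.1 hd
  have hy : y ∈ nbrs G X x := by simp [hnb]
  have hz : z ∈ nbrs G X x := by simp [hnb]
  have hyX := mem_nbrs.1 hy
  have hzX := mem_nbrs.1 hz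
  obtain ⟨hyc, hyd, hyw⟩ := hX.nbr_of_one hx hc hy
  obtain ⟨hzc, hzd, hzw⟩ := hX.nbr_of_one hx hc hz
  have hxy : x ∈ nbrs G X y := mem_nbrs.2 ⟨hx, hyX.2.symm⟩
  have hxz : x ∈ nbrs G X z := mem_nbrs.2 ⟨hx, hzX.2.symm⟩
  obtain ⟨y', hy'x, hy'⟩ := exists_other hyd hxy
  obtain ⟨z', hz'x, hz'⟩ := exists_other hzd hxz
  have adjx : ∀ t ∈ X, G.Adj x t → t = y ∨ t = z := fun t ht hadj => by
    have : t ∈ nbrs G X x := mem_nbrs.2 ⟨ht, hadj⟩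
    simpa [hnb] using this
  have adjy : ∀ t ∈ X, G.Adj y t → t = x ∨ t = y' := fun t ht hadj => by
    have : t ∈ nbrs G X y := mem_nbrs.2 ⟨ht, hadj⟩
    simpa [hy'] using this
  have adjz : ∀ t ∈ X, G.Adj z t → t = x ∨ t = z' := fun t ht hadj => by
    have : t ∈ nbrs G X z := mem_nbrs.2 ⟨ht, hadj⟩
    simpa [hz'] using this
  have hy'm : y' ∈ nbrs G X y := by simp [hy']
  have hz'm : z' ∈ nbrs G X z := by simp [hz']
  have hy'X := mem_nbrs.1 hy'm
  have hz'X := mem_nbrs.1 hz'm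
  have hxne : x ∉ ({y, z} : Finset V) := by simp [hyX.2.ne, hzX.2.ne]
  -- A triangle `x y z` contributes `y` and `z`.
  have hy'z : y' ≠ z := by
    rintro rfl
    have hz'y : z' = y := ((adjz y hyX.1 hy'X.2.symm).resolve_left hyX.2.ne').symm
    subst hz'y
    have h := hX.take_lt' (D := {x, z', y'}) (A := {z', y'})
      (insert_subset hx (insert_subset hyX.1 (singleton_subset_iff.2 hzX.1))) (by simp)
      (subset_insert _ _) (isCapForest_pair (by omega) (by omega)) (by
        intro a ha t ht hadj
        simp only [mem_insert, mem_singleton] at ha ⊢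
        rcases ha with rfl | rfl
        · have := adjy t ht hadj
          tauto
        · have := adjz t ht hadj
          tauto)
    rw [sum_insert hxne, sum_pair hyz, hw, hyw, hzw, card_pair hyz] at h
    norm_num at h
  have hxy' : ¬ G.Adj x y' := fun h => (adjx y' hy'X.1 h).elim hy'X.2.ne' hy'z
  have hzy : ¬ G.Adj z y := fun h =>
    (adjy z hzX.1 h.symm).elim hzX.2.ne' hy'z.symm
  have hcy' : 2 ≤ c y' := by
    have h0 := hX.ne_zero hy'X.1
    by_contra hcon
    have h1 : c y' = 1 := by omega
    have h2 := hX.gain_add_gain_lt hyX.1 hy'x.symm hy'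
    linarith [hX.six_le_gain hyX.1 hxy hc, hX.six_le_gain hyX.1 hy'm h1]
  rcases hX.vertexWeight_of_two_le hy'X.1 hcy' with ⟨hy'd, hy'w⟩ | ⟨hy'd, hy'w⟩
  · -- Delete `x` and absorb `y` into `y'`.
    have hD : ({x, y} : Finset V) ⊆ X := insert_subset hx (singleton_subset_iff.2 hyX.1)
    have h := hX.absorb_lt (D := {x, y}) (e := y) (v := y') hD (by simp)
      (by simp [hy'X.1, hy'x, hy'X.2.ne']) hcy' (fun t ht hadj => by
        have := adjy t ht hadj
        simp only [mem_insert, mem_singleton]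
        tauto)
    have hN : nbrs G {x, y} y' = {y} := by
      ext t
      simp only [mem_nbrs, mem_insert, mem_singleton]
      constructor
      · rintro ⟨rfl | rfl, ht⟩
        · exact absurd ht.symm hxy'
        · rfl
      · rintro rfl
        exact ⟨Or.inr rfl, hy'X.2.symm⟩
    have hcard := card_nbrs_sdiff (G := G) (v := y') hD
    rw [hN, card_singleton, hy'd] at hcard
    rw [show #(nbrs G (X \ {x, y}) y') = 1 by omega, sum_pair hyX.2.ne, hw, hyw, hy'w] at h
    norm_num [weight] at h
  have hxy'z : ∀ {s : Finset V}, y' ∉ s → x ∉ s → y ∉ s → z ∉ s →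
      ∑ t ∈ insert x (insert y (insert z (insert y' s))), vertexWeight G c X t =
        41 + ∑ t ∈ s, vertexWeight G c X t := by
    intro s h1 h2 h3 h4
    rw [sum_insert (by simp [hyX.2.ne, hzX.2.ne, hy'x.symm, h2]),
      sum_insert (by simp [hyz, hy'X.2.ne, h3]), sum_insert (by simp [hy'z.symm, h4]),
      sum_insert h1, hw, hyw, hzw, hy'w]
    ring
  by_cases hzy' : z' = y'
  · -- The path `y y' z` is put into the forest.
    subst hzy'
    have hcardD : #((nbrs G X z').erase y |>.erase z) = 1 := by
      rw [card_erase_of_mem, card_erase_of_mem, hy'd]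
      · exact mem_nbrs.2 ⟨hyX.1, hy'X.2.symm⟩
      · exact mem_erase.2 ⟨hyz.symm, mem_nbrs.2 ⟨hzX.1, hz'X.2.symm⟩⟩
    obtain ⟨p, hp⟩ := card_eq_one.1 hcardD
    have hpm : p ∈ ((nbrs G X z').erase y).erase z := by simp [hp]
    rw [mem_erase, mem_erase, mem_nbrs] at hpm
    have hpw : vertexWeight G c X p ≤ 12 := by
      by_cases h1 : c p = 1
      · linarith [(hX.vertexWeight_of_one hpm.2.2.1 h1).2]
      · have := hX.ne_zero hpm.2.2.1
        rcases hX.vertexWeight_of_two_le hpm.2.2.1 (by omega) with h | h <;> linarith [h.2]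
    have hA : IsCapForest G c (insert z {y, z'}) := by
      refine (isCapForest_pair (c := fun _ => 1) le_rfl le_rfl).insert_end (v := z') subset_rfl
        ?_ (by omega) ?_ (by omega) ?_
      · simp [hyz.symm, hy'z.symm]
      · intro t ht hadj
        rw [mem_insert, mem_singleton] at ht
        rcases ht with rfl | rfl
        · exact absurd hadj hzy
        · rfl
      · intro t ht htz
        rw [mem_insert, mem_singleton] at ht
        rw [ht.resolve_right htz]
        omega
    have hxp : x ≠ p := by
      rintro rfl
      exact hxy' hpm.2.2.2.symm
    have h := hX.take_lt' (D := {x, y, z, z', p}) (A := insert z {y, z'}) (by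
        intro t ht
        simp only [mem_insert, mem_singleton] at ht
        rcases ht with rfl | rfl | rfl | rfl | rfl
        exacts [hx, hyX.1, hzX.1, hy'X.1, hpm.2.2.1]) (by simp) (by
        intro t ht
        simp only [mem_insert, mem_singleton] at ht ⊢
        tauto) hA (by
        intro a ha t ht hadj
        simp only [mem_insert, mem_singleton] at ha ⊢
        rcases ha with rfl | rfl | rfl
        · have := adjz t ht hadj
          tauto
        · have := adjy t ht hadj
          tauto
        · by_contra hcon
          push Not at hcon
          have : t ∈ ((nbrs G X a).erase y).erase z := by
            simp [hcon, mem_nbrs, ht, hadj]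
          rw [hp, mem_singleton] at this
          exact hcon.2.2.2.2 this)
    rw [hxy'z (by simpa using hpm.2.2.2.ne) (by simpa using hxp) (by simpa using hpm.2.1.symm)
      (by simpa using hpm.1.symm), sum_singleton, card_insert_of_notMem
        (by simp [hyz.symm, hy'z.symm]), card_pair hy'X.2.ne] at h
    norm_num at h
    linarith
  · -- The edge `x y` is put into the forest.
    have hD : ({x, y, z, y'} : Finset V) ⊆ X := by
      intro t ht
      simp only [mem_insert, mem_singleton] at ht
      rcases ht with rfl | rfl | rfl | rfl
      exacts [hx, hyX.1, hzX.1, hy'X.1]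
    have h := hX.take_edges_lt (A := {x, y}) hD (by simp) (by
        intro t ht
        simp only [mem_insert, mem_singleton] at ht ⊢
        tauto) (isCapForest_pair (by omega) (by omega)) (by
        intro a ha t ht hadj
        simp only [mem_insert, mem_singleton] at ha ⊢
        rcases ha with rfl | rfl
        · have := adjx t ht hadj
          tauto
        · have := adjy t ht hadj
          tauto) fun v hv => hX.two_le_drop hv
    have h1 := hxy'z (notMem_empty _) (notMem_empty _) (notMem_empty _) (notMem_empty _)
    rw [sum_empty, add_zero, insert_empty_eq] at h1
    rw [h1, card_pair hyX.2.ne] at h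
    have hz'D : z' ∈ nbrs G (X \ {x, y, z, y'}) z := by
      rw [mem_nbrs, mem_sdiff]
      refine ⟨⟨hz'X.1, ?_⟩, hz'X.2⟩
      have : z' ≠ y := by
        rintro rfl
        exact hzy hz'X.2
      simp [hz'x, this, hz'X.2.ne', hzy']
    have h3 : nbrs G {x, y, z, y'} y' ⊆ {y} := by
      intro t ht
      simp only [mem_nbrs, mem_insert, mem_singleton] at ht ⊢
      obtain ⟨rfl | rfl | rfl | rfl, ht⟩ := ht
      · exact absurd ht.symm hxy'
      · rfl
      · exact absurd ((adjz y' hy'X.1 ht.symm).resolve_left hy'x).symm hzy'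
      · exact absurd ht (G.loopless.irrefl _)
    have h4 := card_nbrs_sdiff (G := G) (v := y') hD
    have h5 := card_le_card h3
    rw [card_singleton] at h5
    have h6 : 1 ≤ #(nbrs G (X \ {x, y, z, y'}) z) := card_pos.2 ⟨z', hz'D⟩
    have h7 : 3 ≤ ∑ a ∈ ({z, y'} : Finset V), #(nbrs G (X \ {x, y, z, y'}) a) := by
      rw [sum_pair hy'z.symm]
      omega
    have h8 : 3 ≤ ∑ a ∈ ({x, y, z, y'} : Finset V), #(nbrs G (X \ {x, y, z, y'}) a) :=
      h7.trans (sum_le_sum_of_subset (by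
        intro t ht
        simp only [mem_insert, mem_singleton] at ht ⊢
        tauto))
    have h9 : (3 : ℝ) ≤
        ((∑ a ∈ ({x, y, z, y'} : Finset V), #(nbrs G (X \ {x, y, z, y'}) a) : ℕ) : ℝ) := by
      exact_mod_cast h8
    norm_num at h h9
    linarith

end Critical

/-- The weights are attained: a minimal counterexample has only vertices of capacity at least `2`
and degree `2` or `3`, to which `reach_of_two_le` applies. -/
theorem reach_vertexWeight (X : Finset V) :
    ∀ c : V → ℕ, Reach G c X (∑ v ∈ X, vertexWeight G c X v) := by
  induction X using Finset.strongInduction with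
  | H X ih =>
  intro c
  by_contra hnot
  have hX : Critical G c X := ⟨hnot, fun Y hY c' => ih Y hY c'⟩
  have hc : ∀ v ∈ X, 2 ≤ c v := fun v hv => by
    have h0 := hX.ne_zero hv
    have h1 := hX.ne_one hv
    omega
  refine hnot ((reach_of_two_le X c fun v hv => (min_le_left _ _).trans (hc v hv)).mono ?_)
  refine sum_le_sum fun v hv => ?_
  rcases hX.vertexWeight_of_two_le hv (hc v hv) with ⟨h1, h2⟩ | ⟨h1, h2⟩ <;>
    norm_num [h1, h2]

end Positive

open InducedSubgraphBounds

/-! ### From degrees to weights -/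

section Degrees

lemma fEps_of_three_le {ε : ℝ} {d : ℕ} (hd : 3 ≤ d) :
    fEps ε d = min (3 * ε) (2 / ((d : ℝ) + 1)) := by
  obtain ⟨k, rfl⟩ := Nat.exists_eq_add_of_le' hd
  rfl

lemma fEps_antitone {ε : ℝ} (h0 : 0 ≤ ε) (h1 : ε ≤ 1 / 6) : Antitone (fEps ε) := by
  refine antitone_nat_of_succ_le fun d => ?_
  obtain rfl | rfl | rfl | hd : d = 0 ∨ d = 1 ∨ d = 2 ∨ 3 ≤ d := by omega
  · simp only [fEps]
    linarith
  · simp only [fEps]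
    linarith
  · rw [fEps_of_three_le (by omega)]
    refine (min_le_left _ _).trans ?_
    simp only [fEps]
    linarith
  · rw [fEps_of_three_le (by omega), fEps_of_three_le hd]
    refine min_le_min le_rfl ?_
    push_cast
    gcongr
    linarith

variable {V : Type*} [DecidableEq V] {G : SimpleGraph V} [DecidableRel G.Adj] {X : Finset V}
  {v : V} {ε : ℝ}

/-- The neighbours of `v` that gain at least `ε` from the deletion of `v`. -/
def lowNbrs (G : SimpleGraph V) [DecidableRel G.Adj] (X : Finset V) (v : V) : Finset V :=
  (nbrs G X v).filter fun u => #(nbrs G X u) ≤ 2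

/-- The vertices of degree `1`. -/
def ends (G : SimpleGraph V) [DecidableRel G.Adj] (X : Finset V) : Finset V :=
  X.filter fun u => #(nbrs G X u) = 1

lemma mem_ends : v ∈ ends G X ↔ v ∈ X ∧ #(nbrs G X v) = 1 := by simp [ends]

/-- The capacity that remains for `v` once all ends are in the forest. -/
def endCap (G : SimpleGraph V) [DecidableRel G.Adj] (X : Finset V) (v : V) : ℕ :=
  2 - #(nbrs G (ends G X) v)

lemma nbrs_ends_subset : nbrs G (ends G X) v ⊆ lowNbrs G X v := by
  intro u hu
  rw [mem_nbrs, mem_ends] at hu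
  exact mem_filter.2 ⟨mem_nbrs.2 ⟨hu.1.1, hu.2⟩, by omega⟩

/-- Putting all ends into the forest. -/
lemma reach_union_ends (hlow : ∀ v ∈ X, 3 ≤ #(nbrs G X v) → #(lowNbrs G X v) ≤ 2) {r : ℝ}
    (hr : Reach G (endCap G X) (X \ ends G X) r) :
    Reach G (fun _ => 2) X (r + 18 * #(ends G X)) := by
  obtain ⟨S, h1, h2, h3⟩ := hr
  have hsub : S ∪ ends G X ⊆ X := union_subset (h1.trans sdiff_subset) (filter_subset _ _)
  refine ⟨S ∪ ends G X, hsub, ⟨fun T hT hne => ?_, fun v hv => ?_⟩, ?_⟩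
  · by_cases h : ∃ e ∈ T, e ∈ ends G X
    · obtain ⟨e, heT, he⟩ := h
      exact ⟨e, heT, (card_le_card (nbrs_mono (hT.trans hsub))).trans (mem_ends.1 he).2.le⟩
    · push Not at h
      exact h2.1 T (fun t ht => (mem_union.1 (hT ht)).resolve_right (h t ht)) hne
  · by_cases hd : #(nbrs G X v) ≤ 2
    · exact (card_le_card (nbrs_mono hsub)).trans hd
    · have hvS : v ∈ S := (mem_union.1 hv).resolve_right fun h => by
        have := (mem_ends.1 h).2
        omega
      have h4 := h2.2 v hvS
      have h5 : nbrs G (S ∪ ends G X) v = nbrs G S v ∪ nbrs G (ends G X) v := filter_union _ _ _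
      have h6 := card_union_le (nbrs G S v) (nbrs G (ends G X) v)
      have h7 := (card_le_card (nbrs_ends_subset (G := G) (X := X) (v := v))).trans
        (hlow v (hsub hv) (by omega))
      unfold endCap at h4
      rw [h5]
      change _ ≤ 2
      omega
  · rw [card_union_of_disjoint (disjoint_sdiff_self_left.mono_left h1)]
    push_cast
    linarith

/-- In the graph without its ends the weights are at least the values of `fEps ε`, up to the
amount `ε` that every end transfers to its neighbour. -/
lemma fEps_sub_le_vertexWeight (h0 : 0 ≤ ε) (h1 : ε ≤ 1 / 6)
    (hlow : ∀ v ∈ X, 3 ≤ #(nbrs G X v) → #(lowNbrs G X v) ≤ 2) (hv : v ∈ X \ ends G X) :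
    18 * (fEps ε #(nbrs G X v) - #(nbrs G (ends G X) v) * ε) ≤
      vertexWeight G (endCap G X) (X \ ends G X) v := by
  rw [mem_sdiff, mem_ends] at hv
  have hends : ends G X ⊆ X := filter_subset _ _
  have hcard := card_nbrs_sdiff (G := G) (v := v) hends
  have hne1 : #(nbrs G X v) ≠ 1 := fun h => hv.2 ⟨hv.1, h⟩
  -- A vertex with two ends has no neighbour of degree `2`.
  have hflag : #(nbrs G X v) = 2 → ¬ Flagged G (endCap G X) (X \ ends G X) v := by
    rintro hd ⟨u, hu, hcu⟩
    rw [mem_nbrs, mem_sdiff] at hu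
    have h2 : 2 ≤ #(nbrs G (ends G X) u) := by unfold endCap at hcu; omega
    have hvl : v ∈ lowNbrs G X u := mem_filter.2 ⟨mem_nbrs.2 ⟨hv.1, hu.2.symm⟩, by omega⟩
    have hvn : v ∉ nbrs G (ends G X) u := fun h => hv.2 (mem_ends.1 (mem_nbrs.1 h).1)
    have h3 := card_le_card (insert_subset hvl (nbrs_ends_subset (G := G) (X := X) (v := u)))
    rw [card_insert_of_notMem hvn] at h3
    have h4 : #(lowNbrs G X u) ≤ #(nbrs G X u) := card_le_card (filter_subset _ _)
    have := hlow u hu.1.1 (by omega)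
    omega
  have hle := card_le_card (nbrs_ends_subset (G := G) (X := X) (v := v))
  have hlowv := hlow v hv.1
  unfold vertexWeight
  unfold endCap at hflag ⊢
  rw [show #(nbrs G (X \ ends G X) v) = #(nbrs G X v) - #(nbrs G (ends G X) v) by omega]
  generalize Flagged G (fun v => 2 - #(nbrs G (ends G X) v)) (X \ ends G X) v = b at *
  have hkd : #(nbrs G (ends G X) v) ≤ #(nbrs G X v) := by omega
  generalize #(nbrs G (ends G X) v) = k at *
  generalize #(nbrs G X v) = d at *
  clear hcard
  obtain rfl | rfl | hd : d = 0 ∨ d = 2 ∨ 3 ≤ d := by omega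
  · have : k = 0 := by omega
    subst this
    norm_num [fEps, weight]
  · have hb := hflag rfl
    interval_cases k <;> norm_num [fEps, weight, hb] <;> linarith
  · have hk := hle.trans (hlowv hd)
    have hx1 : fEps ε d ≤ 3 * ε := by rw [fEps_of_three_le hd]; exact min_le_left _ _
    have hx2 : fEps ε d ≤ 2 / ((d : ℝ) + 1) := by
      rw [fEps_of_three_le hd]; exact min_le_right _ _
    have hd' : (3 : ℝ) ≤ d := by exact_mod_cast hd
    obtain rfl | rfl | rfl : k = 0 ∨ k = 1 ∨ k = 2 := by omega
    · have hw : weight (2 - 0) (d - 0) b = 18 * (2 / ((d : ℝ) + 1)) := by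
        have e0 : d ≠ 0 := by omega
        have e1 : d ≠ 1 := by omega
        have e2 : d ≠ 2 := by omega
        simp only [weight, Nat.sub_zero, e0, e1, e2, if_false]
        norm_num
        ring
      rw [hw]
      push_cast
      linarith
    · have hw : weight (2 - 1) (d - 1) b = 24 / d := by
        have e0 : d - 1 ≠ 0 := by omega
        have e1 : d - 1 ≠ 1 := by omega
        have e2 : ((d - 1 : ℕ) : ℝ) + 1 = d := by push_cast [show 1 ≤ d by omega]; ring
        simp only [weight, e0, e1, if_false, e2]
        norm_num
      have h3 : 2 / ((d : ℝ) + 1) ≤ 2 / d := by gcongr; linarith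
      have h4 : 24 / (d : ℝ) = 12 * (2 / d) := by ring
      rw [hw, h4]
      push_cast
      linarith
    · obtain rfl | hd4 : d = 3 ∨ 4 ≤ d := by omega
      · norm_num [weight]
        linarith
      · have hw : weight (2 - 2) (d - 2) b = 6 * (2 / ((d : ℝ) - 1)) := by
          have e0 : d - 2 ≠ 0 := by omega
          have e1 : d - 2 ≠ 1 := by omega
          have e2 : ((d - 2 : ℕ) : ℝ) + 1 = d - 1 := by
            push_cast [show 2 ≤ d by omega]; ring
          simp only [weight, e0, e1, if_false, e2]
          norm_num
          ring
        have h3 : 2 / ((d : ℝ) + 1) ≤ 2 / (d - 1) := by gcongr <;> linarith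
        rw [hw]
        push_cast
        linarith

/-- A vertex of degree at least `3` with three neighbours of degree `1` or `2` is deleted.
If there is none, all ends are put into the forest. -/
theorem reach_fEps (h0 : 0 ≤ ε) (h1 : ε ≤ 1 / 6) (X : Finset V) :
    Reach G (fun _ => 2) X (∑ v ∈ X, 18 * fEps ε #(nbrs G X v)) := by
  induction X using Finset.strongInduction with
  | H X ih =>
  by_contra hnot
  have hlow : ∀ v ∈ X, 3 ≤ #(nbrs G X v) → #(lowNbrs G X v) ≤ 2 := by
    intro v hv hd
    by_contra hcon
    have hD : {v} ⊆ X := singleton_subset_iff.2 hv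
    have h := take_lt_of_not_reach hnot (ih _ (sdiff_ssubset hD (by simp))) hD
      (empty_subset _) isCapForest_empty (by simp)
    have hmono : ∀ u, 0 ≤ 18 * fEps ε #(nbrs G (X \ {v}) u) - 18 * fEps ε #(nbrs G X u) := by
      intro u
      have := fEps_antitone h0 h1 (card_le_card (nbrs_mono (G := G) (v := u)
        (sdiff_subset (s := X) (t := {v}))))
      linarith
    have hsub : lowNbrs G X v ⊆ X \ {v} := fun u hu => by
      have := mem_nbrs.1 (mem_filter.1 hu).1
      simp [this.1, this.2.ne']
    have hsum := sum_le_sum_of_subset_of_nonneg hsub fun u _ _ => hmono u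
    have hgain : ∀ u ∈ lowNbrs G X v,
        18 * ε ≤ 18 * fEps ε #(nbrs G (X \ {v}) u) - 18 * fEps ε #(nbrs G X u) := by
      intro u hu
      obtain ⟨hu1, hu2⟩ := mem_filter.1 hu
      have huX := mem_nbrs.1 hu1
      rw [Critical.card_nbrs_sdiff_singleton hv hu1]
      have hpos : 1 ≤ #(nbrs G X u) := card_pos.2 ⟨v, mem_nbrs.2 ⟨hv, huX.2.symm⟩⟩
      generalize #(nbrs G X u) = d at *
      interval_cases d <;> norm_num [fEps] <;> linarith
    have h2 := card_nsmul_le_sum _ _ _ hgain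
    have h3 : (3 : ℝ) ≤ #(lowNbrs G X v) := by exact_mod_cast (by omega : 3 ≤ #(lowNbrs G X v))
    have h4 : fEps ε #(nbrs G X v) ≤ 3 * ε := by
      rw [fEps_of_three_le hd]; exact min_le_left _ _
    rw [nsmul_eq_mul] at h2
    simp only [card_empty, Nat.cast_zero, mul_zero, zero_add, sum_singleton] at h
    nlinarith
  refine hnot ((reach_union_ends hlow (reach_vertexWeight _ _)).mono ?_)
  have hends : ends G X ⊆ X := filter_subset _ _
  rw [← sum_sdiff hends]
  have hE : ∑ v ∈ ends G X, 18 * fEps ε #(nbrs G X v) = #(ends G X) * (18 * (1 - ε)) := by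
    rw [← nsmul_eq_mul, ← sum_const]
    exact sum_congr rfl fun v hv => by rw [(mem_ends.1 hv).2]; rfl
  have hY := sum_le_sum fun v hv => fEps_sub_le_vertexWeight h0 h1 hlow (v := v) hv
  have hk : ∑ v ∈ X \ ends G X, #(nbrs G (ends G X) v) ≤ #(ends G X) := by
    rw [sum_card_nbrs_comm, card_eq_sum_ones]
    refine sum_le_sum fun e he => ?_
    exact (card_le_card (nbrs_mono sdiff_subset)).trans (mem_ends.1 he).2.le
  have hk' : (∑ v ∈ X \ ends G X, (#(nbrs G (ends G X) v) : ℝ)) ≤ #(ends G X) := by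
    exact_mod_cast hk
  have h5 := mul_le_mul_of_nonneg_right hk' h0
  rw [← mul_sum, sum_sub_distrib, ← sum_mul] at hY
  rw [hE, ← mul_sum]
  linarith

end Degrees

/-! ### Linear forests and degrees -/

section LinearForests

/-- A connected acyclic finite graph of maximum degree at most `2` is a path: a longest path
contains, with every vertex, all its neighbours. -/
lemma exists_iso_pathGraph {W : Type*} [Finite W] {C : SimpleGraph W} (hconn : C.Connected)
    (hac : C.IsAcyclic)
    (hdeg : ∀ v a b d, C.Adj v a → C.Adj v b → C.Adj v d → a ≠ b → a ≠ d → b ≠ d → False) :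
    ∃ n, Nonempty (C ≃g SimpleGraph.pathGraph n) := by
  have := hconn.nonempty
  obtain ⟨u, v, p, hp, hmax⟩ := SimpleGraph.Walk.exists_isPath_forall_isPath_length_le_length C
  have hinj : ∀ i j, i ≤ p.length → j ≤ p.length → p.getVert i = p.getVert j → i = j :=
    fun i j hi hj h => hp.getVert_injOn hi hj h
  have hclosed : ∀ a ∈ p.support, ∀ b, C.Adj a b → b ∈ p.support := by
    intro a ha b hab
    by_contra hb
    obtain ⟨i, rfl, hi⟩ := SimpleGraph.Walk.mem_support_iff_exists_getVert.1 ha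
    have hbi : ∀ j, b ≠ p.getVert j := fun j h => hb (h ▸ p.getVert_mem_support j)
    obtain rfl | hi0 := Nat.eq_zero_or_pos i
    · rw [p.getVert_zero] at hab
      have h := hmax _ _ _ (hp.cons hb (h := hab.symm))
      simp at h
    obtain rfl | hil := hi.eq_or_lt
    · rw [p.getVert_length] at hab
      have h := hmax _ _ _ (hp.concat hb hab)
      simp at h
    have h1 := p.adj_getVert_succ hil
    have h2 := p.adj_getVert_succ (i := i - 1) (by omega)
    rw [Nat.sub_add_cancel hi0] at h2
    refine hdeg _ _ _ _ h2.symm h1 hab (fun h => ?_) (hbi _).symm (hbi _).symm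
    have := hinj _ _ (by omega) (by omega) h
    omega
  have hall : ∀ w, w ∈ p.support := by
    intro w
    obtain ⟨q⟩ := hconn.preconnected u w
    have : ∀ {a b : W} (q : C.Walk a b), a ∈ p.support → b ∈ p.support := by
      intro a b q
      induction q with
      | nil => exact id
      | cons h _ ih => exact fun ha => ih (hclosed _ ha _ h)
    exact this q p.start_mem_support
  -- An edge between two vertices of the path is the unique path between them.
  have hadj : ∀ i j, i < j → j ≤ p.length → C.Adj (p.getVert i) (p.getVert j) → i + 1 = j := by
    intro i j hij hj h
    have hv : (p.drop i).getVert (j - i) = p.getVert j := by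
      rw [SimpleGraph.Walk.drop_getVert]
      congr 1
      omega
    let q : C.Walk (p.getVert i) (p.getVert j) := ((p.drop i).take (j - i)).copy rfl hv
    have hq : q.IsPath := by
      simp only [q, SimpleGraph.Walk.isPath_copy]
      exact (hp.drop i).take _
    have heq : (⟨q, hq⟩ : C.Path _ _) = SimpleGraph.Path.singleton h :=
      (hac.subsingleton_path _ _).elim _ _
    have hlen : q.length = 1 := by
      have := congrArg (fun r : C.Path _ _ => r.1.length) heq
      simpa [SimpleGraph.Path.singleton] using this
    simp only [q, SimpleGraph.Walk.length_copy, SimpleGraph.Walk.take_length,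
      SimpleGraph.Walk.drop_length] at hlen
    omega
  let f : Fin (p.length + 1) → W := fun i => p.getVert i
  have hf : Function.Bijective f := by
    refine ⟨fun i j h => Fin.ext (hinj _ _ (by omega) (by omega) h), fun w => ?_⟩
    obtain ⟨i, hi, hil⟩ := SimpleGraph.Walk.mem_support_iff_exists_getVert.1 (hall w)
    exact ⟨⟨i, by omega⟩, hi⟩
  refine ⟨p.length + 1, ⟨SimpleGraph.Iso.symm ⟨Equiv.ofBijective f hf, ?_⟩⟩⟩
  intro i j
  rw [SimpleGraph.pathGraph_adj]
  change C.Adj (p.getVert i) (p.getVert j) ↔ _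
  constructor
  · intro h
    rcases lt_trichotomy (i : ℕ) j with hij | hij | hij
    · exact Or.inl (hadj _ _ hij (by omega) h)
    · rw [hij] at h
      exact absurd h (C.loopless.irrefl _)
    · exact Or.inr (hadj _ _ hij (by omega) h.symm)
  · rintro (h | h)
    · rw [← h]
      exact p.adj_getVert_succ (by omega)
    · rw [← h]
      exact (p.adj_getVert_succ (by omega)).symm

/-- A linear forest has no triangle and no vertex of degree `3`, since its components embed into
path graphs. -/
lemma no_triangle_no_claw {W : Type} {H : SimpleGraph W} (hH : LinearForest W H)
    {v a b d : W} (ha : H.Adj v a) (hb : H.Adj v b) (hab : a ≠ b) :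
    ¬ H.Adj a b ∧ (H.Adj v d → d = a ∨ d = b) := by
  obtain ⟨n, ⟨φ⟩⟩ := hH.2 (H.connectedComponentMk v)
  have hmem : ∀ w, H.Adj v w → w ∈ H.connectedComponentMk v := fun w hw =>
    (SimpleGraph.ConnectedComponent.mem_supp_iff _ _).2
      (SimpleGraph.ConnectedComponent.sound hw.symm.reachable)
  have hv : v ∈ H.connectedComponentMk v := rfl
  have key : ∀ {x y : W} (hx : x ∈ H.connectedComponentMk v) (hy : y ∈ H.connectedComponentMk v),
      H.Adj x y → (φ ⟨x, hx⟩ : ℕ) + 1 = φ ⟨y, hy⟩ ∨ (φ ⟨y, hy⟩ : ℕ) + 1 = φ ⟨x, hx⟩ := by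
    intro x y hx hy hxy
    rw [← SimpleGraph.pathGraph_adj, φ.map_adj_iff]
    exact hxy
  have hinj : ∀ {x y : W} (hx : x ∈ H.connectedComponentMk v) (hy : y ∈ H.connectedComponentMk v),
      (φ ⟨x, hx⟩ : ℕ) = φ ⟨y, hy⟩ → x = y := by
    intro x y hx hy h
    exact congrArg Subtype.val (φ.injective (Fin.ext h))
  have h1 := key hv (hmem a ha) ha
  have h2 := key hv (hmem b hb) hb
  have h3 : (φ ⟨a, hmem a ha⟩ : ℕ) ≠ φ ⟨b, hmem b hb⟩ := fun h => hab (hinj _ _ h)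
  refine ⟨fun h => ?_, fun hd => ?_⟩
  · have h4 := key (hmem a ha) (hmem b hb) h
    omega
  · have h4 := key hv (hmem d hd) hd
    by_contra hcon
    push Not at hcon
    have h5 : (φ ⟨d, hmem d hd⟩ : ℕ) ≠ φ ⟨a, hmem a ha⟩ := fun h => hcon.1 (hinj _ _ h)
    have h6 : (φ ⟨d, hmem d hd⟩ : ℕ) ≠ φ ⟨b, hmem b hb⟩ := fun h => hcon.2 (hinj _ _ h)
    omega

variable {V : Type} [DecidableEq V] {G : SimpleGraph V} [DecidableRel G.Adj] {S : Finset V}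

lemma IsCapForest.isAcyclic {c : V → ℕ} (h : IsCapForest G c S) :
    (G.induce (S : Set V)).IsAcyclic := by
  intro v p hp
  obtain ⟨x, hx, hx1⟩ := h.1 (p.support.toFinset.image Subtype.val)
    (by
      intro t ht
      obtain ⟨s, -, rfl⟩ := mem_image.1 ht
      exact s.2) ⟨v, mem_image.2 ⟨v, by simp, rfl⟩⟩
  obtain ⟨y, hy, rfl⟩ := mem_image.1 hx
  obtain ⟨a, b, hab, heq⟩ := Set.ncard_eq_two.1
    (hp.ncard_neighborSet_toSubgraph_eq_two (List.mem_toFinset.1 hy))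
  have hmem : ∀ t ∈ p.toSubgraph.neighborSet y,
      (t : V) ∈ nbrs G (p.support.toFinset.image Subtype.val) y := by
    intro t ht
    have ht' : p.toSubgraph.Adj y t := ht
    refine mem_nbrs.2 ⟨mem_image.2 ⟨t, List.mem_toFinset.2 ?_, rfl⟩, ht'.adj_sub⟩
    exact p.mem_verts_toSubgraph.1 ht'.snd_mem
  have h2 : ({(a : V), (b : V)} : Finset V) ⊆ nbrs G (p.support.toFinset.image Subtype.val) y :=
    insert_subset (hmem a (by simp [heq])) (singleton_subset_iff.2 (hmem b (by simp [heq])))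
  have h3 := card_le_card h2
  rw [card_pair fun h => hab (Subtype.ext h)] at h3
  omega

lemma IsCapForest.linearForest (h : IsCapForest G (fun _ => 2) S) :
    LinearForest _ (G.induce (S : Set V)) := by
  refine ⟨h.isAcyclic, fun C => ?_⟩
  refine exists_iso_pathGraph C.connected_toSimpleGraph (h.isAcyclic.induce _) ?_
  intro v a b d ha hb hd hab had hbd
  have hmem : ∀ t : C, C.toSimpleGraph.Adj v t → (t.1.1 : V) ∈ nbrs G S v.1.1 :=
    fun t ht => mem_nbrs.2 ⟨t.1.2, ht⟩
  have hne : ∀ {s t : C}, s ≠ t → s.1.1 ≠ t.1.1 :=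
    fun hst h => hst (Subtype.ext (Subtype.ext h))
  have hsub : ({a.1.1, b.1.1, d.1.1} : Finset V) ⊆ nbrs G S v.1.1 :=
    insert_subset (hmem a ha) (insert_subset (hmem b hb) (singleton_subset_iff.2 (hmem d hd)))
  have h3 := card_le_card hsub
  rw [card_eq_three.2 ⟨_, _, _, hne hab, hne had, hne hbd, rfl⟩] at h3
  have h4 : #(nbrs G S v.1.1) ≤ 2 := h.2 v.1.1 v.1.2
  omega

theorem isLowerBound_fEps {ε : ℝ} (h0 : 0 ≤ ε) (h1 : ε ≤ 1 / 6) :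
    IsLowerBound LinearForest (fEps ε) := by
  refine ⟨fun d => ?_, fun V _ G _ => ?_⟩
  · refine ⟨?_, fEps_antitone h0 h1 (Nat.zero_le d)⟩
    obtain rfl | rfl | rfl | hd : d = 0 ∨ d = 1 ∨ d = 2 ∨ 3 ≤ d := by omega
    · norm_num [fEps]
    · simp only [fEps]
      linarith
    · norm_num [fEps]
    · rw [fEps_of_three_le hd]
      positivity
  · classical
    obtain ⟨S, -, hS, hle⟩ := reach_fEps (G := G) h0 h1 univ
    have hcard : #S ≤ maxInducedOrder LinearForest G := by
      unfold maxInducedOrder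
      exact le_sup (f := card) (mem_filter.2 ⟨mem_univ S, hS.linearForest⟩)
    have hdeg : ∀ v, #(nbrs G univ v) = G.degree v := fun v => by
      rw [← SimpleGraph.card_neighborFinset_eq_degree]
      congr 1
      ext w
      simp [mem_nbrs]
    simp only [hdeg] at hle
    rw [← mul_sum] at hle
    have hcard' : (#S : ℝ) ≤ maxInducedOrder LinearForest G := by exact_mod_cast hcard
    linarith

end LinearForests

/-! ### Upper bounds for lower bounds -/

section Domination

variable {f : ℕ → ℝ}

lemma maxInducedOrder_le {V : Type} [Fintype V] {G : SimpleGraph V} {m : ℕ}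
    (h : ∀ S : Finset V, LinearForest _ (G.induce (S : Set V)) → #S ≤ m) :
    maxInducedOrder LinearForest G ≤ m := by
  classical
  unfold maxInducedOrder
  exact Finset.sup_le fun S hS => h S (mem_filter.1 hS).2

/-- Complete graphs bound the values at all degrees `d ≥ 2`. -/
lemma le_two_div (hf : IsLowerBound LinearForest f) {d : ℕ} (hd : 2 ≤ d) :
    f d ≤ 2 / ((d : ℝ) + 1) := by
  classical
  have h := hf.2 (Fin (d + 1)) ⊤
  have hmax : maxInducedOrder LinearForest (⊤ : SimpleGraph (Fin (d + 1))) ≤ 2 := by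
    refine maxInducedOrder_le fun S hS => ?_
    by_contra hcon
    obtain ⟨a, ha, b, hb, e, he, hab, hae, hbe⟩ := two_lt_card.1 (not_le.1 hcon)
    have := (no_triangle_no_claw hS (v := ⟨a, ha⟩) (a := ⟨b, hb⟩) (b := ⟨e, he⟩) (d := ⟨b, hb⟩)
      (by simpa using hab) (by simpa using hae) (by simpa using hbe)).1
    simp at this
    exact hbe this
  have hmax' : (maxInducedOrder LinearForest (⊤ : SimpleGraph (Fin (d + 1))) : ℝ) ≤ 2 := by
    exact_mod_cast hmax
  simp only [SimpleGraph.complete_graph_degree, Fintype.card_fin, Nat.add_sub_cancel, sum_const,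
    card_univ, nsmul_eq_mul] at h
  push_cast at h
  rw [le_div_iff₀ (by positivity)]
  linarith

/-- The complete graph on `n` vertices with three ends attached to every vertex. The vertex
`(i, 0)` is the `i`-th vertex of the complete graph. -/
def coronaGraph (n : ℕ) : SimpleGraph (Fin n × Fin 4) where
  Adj x y := (x.2 = 0 ∧ y.2 = 0 ∧ x.1 ≠ y.1) ∨
    (x.1 = y.1 ∧ ((x.2 = 0 ∧ y.2 ≠ 0) ∨ (x.2 ≠ 0 ∧ y.2 = 0)))
  symm := ⟨fun x y h => by
    rcases h with ⟨h1, h2, h3⟩ | ⟨h1, h2 | h2⟩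
    · exact Or.inl ⟨h2, h1, h3.symm⟩
    · exact Or.inr ⟨h1.symm, Or.inr ⟨h2.2, h2.1⟩⟩
    · exact Or.inr ⟨h1.symm, Or.inl ⟨h2.2, h2.1⟩⟩⟩
  loopless := ⟨fun x h => by
    rcases h with ⟨_, _, h⟩ | ⟨_, h | h⟩
    · exact h rfl
    · exact h.2 h.1
    · exact h.1 h.2⟩

lemma coronaGraph_adj {n : ℕ} {x y : Fin n × Fin 4} : (coronaGraph n).Adj x y ↔
    (x.2 = 0 ∧ y.2 = 0 ∧ x.1 ≠ y.1) ∨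
      (x.1 = y.1 ∧ ((x.2 = 0 ∧ y.2 ≠ 0) ∨ (x.2 ≠ 0 ∧ y.2 = 0))) := Iff.rfl

open Classical in
lemma degree_coronaGraph_zero {n : ℕ} (i : Fin n) :
    (coronaGraph n).degree (i, 0) = n - 1 + 3 := by
  rw [← SimpleGraph.card_neighborFinset_eq_degree]
  have : (coronaGraph n).neighborFinset (i, 0) =
      (univ.erase i) ×ˢ {0} ∪ {i} ×ˢ (univ.erase (0 : Fin 4)) := by
    ext ⟨j, b⟩
    simp only [SimpleGraph.mem_neighborFinset, coronaGraph_adj, mem_union, mem_product, mem_erase,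
      mem_univ, and_true, mem_singleton]
    tauto
  rw [this, card_union_of_disjoint]
  · simp
  · rw [disjoint_left]
    rintro ⟨j, b⟩ h1 h2
    simp only [mem_product, mem_erase, mem_singleton] at h1 h2
    exact h2.2.1 h1.2

open Classical in
lemma degree_coronaGraph_ne_zero {n : ℕ} (i : Fin n) {a : Fin 4} (ha : a ≠ 0) :
    (coronaGraph n).degree (i, a) = 1 := by
  rw [← SimpleGraph.card_neighborFinset_eq_degree, card_eq_one]
  refine ⟨(i, 0), ?_⟩
  ext ⟨j, b⟩
  simp only [SimpleGraph.mem_neighborFinset, coronaGraph_adj, mem_singleton, Prod.mk.injEq]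
  tauto

/-- An induced linear forest of `coronaGraph n` misses one of the four vertices `(i, a)`,
for every `i`. -/
lemma three_mul_add_le (hf : IsLowerBound LinearForest f) {d : ℕ} (hd : 3 ≤ d) :
    3 * f 1 + f d ≤ 3 := by
  classical
  obtain ⟨n, rfl⟩ : ∃ n, d = n + 3 := ⟨d - 3, by omega⟩
  have h := hf.2 _ (coronaGraph (n + 1))
  have hmax : maxInducedOrder LinearForest (coronaGraph (n + 1)) ≤ (n + 1) * 3 := by
    refine maxInducedOrder_le fun S hS => ?_
    rw [card_eq_sum_card_fiberwise (f := Prod.fst) (t := univ) (by simp)]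
    refine (sum_le_card_nsmul _ _ 3 fun i _ => ?_).trans (by simp)
    by_contra hcon
    have hsub : S.filter (fun x => x.1 = i) ⊆ ({i} : Finset (Fin (n + 1))) ×ˢ univ := by
      rintro ⟨j, b⟩ hx
      simpa using (mem_filter.1 hx).2.symm
    have heq := eq_of_subset_of_card_le hsub (by simp; omega)
    have hmem : ∀ a, (i, a) ∈ S := fun a => by
      have : (i, a) ∈ S.filter (fun x => x.1 = i) := by rw [heq]; simp
      exact (mem_filter.1 this).1
    have hadj : ∀ a : Fin 4, a ≠ 0 →
        ((coronaGraph (n + 1)).induce (S : Set _)).Adj ⟨(i, 0), hmem 0⟩ ⟨(i, a), hmem a⟩ :=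
      fun a ha => Or.inr ⟨rfl, Or.inl ⟨rfl, ha⟩⟩
    have := (no_triangle_no_claw hS (hadj 1 (by decide)) (hadj 2 (by decide)) (by simp)
      (d := ⟨(i, 3), hmem 3⟩)).2 (hadj 3 (by decide))
    simp at this
  have hmax' : (maxInducedOrder LinearForest (coronaGraph (n + 1)) : ℝ) ≤ (n + 1) * 3 := by
    exact_mod_cast hmax
  have hsum : ∑ v : Fin (n + 1) × Fin 4, f ((coronaGraph (n + 1)).degree v) =
      (n + 1) * (f (n + 3) + 3 * f 1) := by
    rw [Fintype.sum_prod_type]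
    have : ∀ i : Fin (n + 1), ∑ a : Fin 4, f ((coronaGraph (n + 1)).degree (i, a)) =
        f (n + 3) + 3 * f 1 := by
      intro i
      rw [Fin.sum_univ_four, degree_coronaGraph_zero, degree_coronaGraph_ne_zero i (by decide),
        degree_coronaGraph_ne_zero i (by decide), degree_coronaGraph_ne_zero i (by decide),
        Nat.add_sub_cancel]
      ring
    simp only [this, sum_const, card_univ, Fintype.card_fin, nsmul_eq_mul]
    push_cast
    ring
  have h2 := (hsum ▸ h).trans hmax'
  have hpos : (0 : ℝ) < n + 1 := by positivity
  have := le_of_mul_le_mul_left h2 hpos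
  linarith

theorem exists_isDominatedBy_fEps (hf : IsLowerBound LinearForest f) :
    ∃ ε : ℝ, 0 ≤ ε ∧ ε ≤ 1 / 6 ∧ IsDominatedBy f (fEps ε) := by
  have hf1 := (hf.1 1).2
  refine ⟨min (1 - f 1) (1 / 6), le_min (by linarith) (by norm_num), min_le_right _ _,
    fun d => ?_⟩
  obtain rfl | rfl | rfl | hd : d = 0 ∨ d = 1 ∨ d = 2 ∨ 3 ≤ d := by omega
  · exact (hf.1 0).2
  · have := min_le_left (1 - f 1) (1 / 6)
    simp only [fEps]
    linarith
  · have := le_two_div hf le_rfl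
    norm_num at this
    exact this
  · have h2 := le_two_div hf (d := d) (by omega)
    have h3 := three_mul_add_le hf hd
    rw [fEps_of_three_le hd]
    refine le_min ?_ h2
    have h4 : 2 / ((d : ℝ) + 1) ≤ 1 / 2 := by
      have : (3 : ℝ) ≤ d := by exact_mod_cast hd
      rw [div_le_div_iff₀ (by positivity) (by norm_num)]
      linarith
    rcases min_choice (1 - f 1) (1 / 6) with h | h <;> rw [h] <;> linarith

/-- No two of the functions `fEps ε` are comparable, as their values at `1` and `3` show. -/
theorem isExtremalLowerBound_fEps {ε : ℝ} (h0 : 0 ≤ ε) (h1 : ε ≤ 1 / 6) :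
    IsExtremalLowerBound LinearForest (fEps ε) := by
  refine ⟨isLowerBound_fEps h0 h1, ?_⟩
  rintro ⟨g, hg, hg0, hlb⟩
  obtain ⟨ε', h0', h1', hdom⟩ := exists_isDominatedBy_fEps hlb
  have hε : ε' = ε := by
    have e1 := hdom 1
    have e3 := hdom 3
    rw [Pi.add_apply, fEps_of_three_le le_rfl, fEps_of_three_le le_rfl] at e3
    simp only [Pi.add_apply, fEps] at e1
    have g1 := (hg 1).1
    have g3 := (hg 3).1
    norm_num at e3
    have e4 := min_le_left (3 * ε') (1 / 2)
    rw [min_eq_left (by linarith : 3 * ε ≤ 1 / 2)] at e3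
    norm_num at e3 e4
    apply le_antisymm <;> linarith
  subst hε
  refine hg0 (funext fun d => le_antisymm ?_ (hg d).1)
  have := hdom d
  simp only [Pi.add_apply] at this
  simpa using this

end Domination

end LinearForestBound

theorem mainTheorem3 :
    (∀ ε : ℝ, 0 ≤ ε → ε ≤ 1 / 6 →
      InducedSubgraphBounds.IsLowerBound InducedSubgraphBounds.LinearForest
          (InducedSubgraphBounds.fEps ε) ∧
        InducedSubgraphBounds.IsExtremalLowerBound InducedSubgraphBounds.LinearForest
          (InducedSubgraphBounds.fEps ε)) ∧
    ∀ f : ℕ → ℝ, InducedSubgraphBounds.IsLowerBound InducedSubgraphBounds.LinearForest f →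
      ∃ ε : ℝ, 0 ≤ ε ∧ ε ≤ 1 / 6 ∧
        InducedSubgraphBounds.IsDominatedBy f (InducedSubgraphBounds.fEps ε) :=
  ⟨fun _ h0 h1 => ⟨LinearForestBound.isLowerBound_fEps h0 h1,
    LinearForestBound.isExtremalLowerBound_fEps h0 h1⟩,
    fun _ hf => LinearForestBound.exists_isDominatedBy_fEps hf⟩
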